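/- Let $G$ be a free group of finite rank $d\ge 2$ with free generators $a_1,\dots,a_d$, let $|t|$ be the length of the reduced word $t\in G$ (its distance from the identity $e$ in the Cayley graph), and let $E_n=\{t\in G:|t|\le n\}$. Let $0<\alpha<2$, let $(S,\mathcal S,m)$ be a standard Borel space with a $\sigma$-finite measure, and let $\{\phi_t\}_{t\in G}$ be a nonsingular action: measurable maps $\phi_t:S\to S$ with $\phi_e=\mathrm{id}$, $\phi_{uv}=\phi_v\circ\phi_u$ and $m\circ\phi_t\sim m$. Let $c_t:S\to\{-1,1\}$, $t\in G$, be measurable (for instance a cocycle of the action; the cocycle identity is not needed). For $f\in\mathcal L^\alpha(S,m)$ put $$f_t(s)=c_t(s)\Big(\frac{d(m\circ\phi_t)}{dm}(s)\Big)^{1/\alpha}f(\phi_t(s)),\qquad b_n(f)=\Big(\int_S\max_{t\in E_n}|f_t(s)|^\alpha\,m(ds)\Big)^{1/\alpha}.$$ Call a measurable set $C\subseteq S$ degenerate if $b_n(g)/|E_n|^{1/\alpha}\to0$ for every $g\in\mathcal L^\alpha(S,m)$ supported on $C$. Let $\mathcal B$ be the measurable union of all degenerate sets (the least measurable set, modulo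 $m$-null sets, that contains every degenerate set modulo $m$-null sets), and let the nondegenerate part be $\mathcal A=S\setminus\mathcal B$. Let $f\in\mathcal L^\alpha(S,m)$ be such that $m(\{f\ne0\}\cap\mathcal A)>0$. Then $$\liminf_{n\to\infty}\frac{b_n(f)}{|E_n|^{1/\alpha}}>0 .$$ Moreover, let $\{X_t\}_{t\in G}$ be any symmetric $\alpha$-stable random field with the finite-dimensional distributions of $\big(\int_S f_t\,dM\big)_{t\in G}$, where $M$ is a symmetric $\alpha$-stable random measure with control measure $m$; that is, $\mathbb E\exp\big(i\sum_{t\in T}\theta_tX_t\big)=\exp\big(-\int_S\big|\sum_{t\in T}\theta_tf_t\big|^\alpha dm\big)$ for all finite $T\subset G$ and all real $\theta_t$. Put $M_n=\max_{t\in E_n}|X_t|$. Then every subsequence $(M_{n_k})$ of $(M_n)$ has a further subsequence $(M_{n_{k_\ell}})$ for which there is a constant $c>0$ with $$M_{n_{k_\ell}}/|E_{n_{k_\ell}}|^{1/\alpha}\Rightarrow c\,Z_\alpha\qquad(\ell\to\infty),$$ where $Z_\alpha$ has the Fréchet distribution function $P(Z_\alpha\le x)=e^{-x^{-\alpha}}$,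 $x>0$. -/

import Mathlib

open MeasureTheory Filter Topology

namespace StableField

/-! ### Balls of the free group -/

theorem finite_norm_le (d n : ℕ) : {t : FreeGroup (Fin d) | t.norm ≤ n}.Finite := by
  refine ((List.finite_length_le (Fin d × Bool) n).image FreeGroup.mk).subset ?_
  intro t ht
  exact ⟨t.toWord, ht, FreeGroup.mk_toWord⟩

/-- The ball `E_n` of radius `n` around the identity of the free group of rank `d`.
`FreeGroup.norm t` is the length of the reduced word of `t`, that is, the distance from the
identity to `t` in the Cayley graph (the `2d`-regular tree). -/
noncomputable def ball (d n : ℕ) : Finset (FreeGroup (Fin d)) :=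
  (finite_norm_le d n).toFinset

theorem ball_nonempty (d n : ℕ) : (ball d n).Nonempty :=
  ⟨1, by simp [ball]⟩

/-! ### Nonsingular actions and the kernels they generate -/

/-- The measure `A ↦ m (φ_t A)`, as the push-forward of `m` under `φ_{t⁻¹}`, the inverse
map of `φ_t`. -/
noncomputable def compMeasure {G S : Type*} [Group G] [MeasurableSpace S] (m : Measure S)
    (φ : G → S → S) (t : G) : Measure S :=
  m.map (φ t⁻¹)

/-- A nonsingular action of `G` on `(S, m)`: measurable maps with `φ_e = id` and
`φ_{uv} = φ_v ∘ φ_u`, such that `m ∘ φ_t` and `m` are equivalent for every `t`. -/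
structure IsNonsingularAction {G S : Type*} [Group G] [MeasurableSpace S] (m : Measure S)
    (φ : G → S → S) : Prop where
  measurable : ∀ t, Measurable (φ t)
  map_one : φ 1 = id
  map_mul : ∀ u v, φ (u * v) = φ v ∘ φ u
  ac : ∀ t, compMeasure m φ t ≪ m
  ac' : ∀ t, m ≪ compMeasure m φ t

/-- For a nonsingular action `compMeasure m φ t` is indeed `m ∘ φ_t`. -/
theorem compMeasure_apply {G S : Type*} [Group G] [MeasurableSpace S] {m : Measure S}
    {φ : G → S → S} (h : IsNonsingularAction m φ) (t : G) {A : Set S} (hA : MeasurableSet A) :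
    compMeasure m φ t A = m (φ t '' A) := by
  have h1 : Function.LeftInverse (φ t⁻¹) (φ t) := fun s => by
    have := congrFun (h.map_mul t t⁻¹) s
    simpa [h.map_one] using this.symm
  have h2 : Function.RightInverse (φ t⁻¹) (φ t) := fun s => by
    have := congrFun (h.map_mul t⁻¹ t) s
    simpa [h.map_one] using this.symm
  rw [compMeasure, Measure.map_apply (h.measurable _) hA, Set.image_eq_preimage_of_inverse h1 h2]

/-- The kernel `f_t(s) = c_t(s) (d(m ∘ φ_t)/dm (s))^{1/α} f(φ_t s)`. -/
noncomputable def kernel {G S : Type*} [Group G] [MeasurableSpace S] (α : ℝ) (m : Measure S)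
    (φ : G → S → S) (c : G → S → ℝ) (f : S → ℝ) (t : G) (s : S) : ℝ :=
  c t s * ((compMeasure m φ t).rnDeriv m s).toReal ^ (1 / α) * f (φ t s)

/-- `b_n(f) = (∫ max_{t ∈ E_n} |f_t|^α dm)^{1/α}`. -/
noncomputable def b {d : ℕ} {S : Type*} [MeasurableSpace S] (α : ℝ) (m : Measure S)
    (φ : FreeGroup (Fin d) → S → S) (c : FreeGroup (Fin d) → S → ℝ) (f : S → ℝ) (n : ℕ) : ℝ :=
  (∫ s, (ball d n).sup' (ball_nonempty d n) (fun t => |kernel α m φ c f t s| ^ α) ∂m) ^ (1 / α)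

/-- The normalised sequence `b_n(f) / |E_n|^{1/α}`. -/
noncomputable def bRatio {d : ℕ} {S : Type*} [MeasurableSpace S] (α : ℝ) (m : Measure S)
    (φ : FreeGroup (Fin d) → S → S) (c : FreeGroup (Fin d) → S → ℝ) (f : S → ℝ) (n : ℕ) : ℝ :=
  b α m φ c f n / ((ball d n).card : ℝ) ^ (1 / α)

/-! ### The degenerate and the nondegenerate part -/

/-- The measurable set `C` is degenerate: `b_n(g) / |E_n|^{1/α} → 0` for all `g ∈ L^α(S, m)`
that are supported on `C`. -/
def IsDegenerateSet {d : ℕ} {S : Type*} [MeasurableSpace S] (α : ℝ) (m : Measure S)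
    (φ : FreeGroup (Fin d) → S → S) (c : FreeGroup (Fin d) → S → ℝ) (C : Set S) : Prop :=
  MeasurableSet C ∧ ∀ g : S → ℝ, MemLp g (ENNReal.ofReal α) m → (∀ᵐ s ∂m, s ∉ C → g s = 0) →
    Tendsto (bRatio α m φ c g) atTop (𝓝 0)

/-- `B` is (a version of) the degenerate part: the measurable union of all degenerate sets,
that is, the least measurable set modulo `m` which contains every degenerate set modulo `m`. -/
structure IsDegeneratePart {d : ℕ} {S : Type*} [MeasurableSpace S] (α : ℝ) (m : Measure S)
    (φ : FreeGroup (Fin d) → S → S) (c : FreeGroup (Fin d) → S → ℝ) (B : Set S) : Prop where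
  measurableSet : MeasurableSet B
  contains : ∀ C, IsDegenerateSet α m φ c C → C ≤ᵐ[m] B
  least : ∀ U, MeasurableSet U → (∀ C, IsDegenerateSet α m φ c C → C ≤ᵐ[m] U) → B ≤ᵐ[m] U

/-- `A` is (a version of) the nondegenerate part: the complement of the degenerate part. -/
def IsNondegeneratePart {d : ℕ} {S : Type*} [MeasurableSpace S] (α : ℝ) (m : Measure S)
    (φ : FreeGroup (Fin d) → S → S) (c : FreeGroup (Fin d) → S → ℝ) (A : Set S) : Prop :=
  IsDegeneratePart α m φ c Aᶜ

/-- The nondegenerate part exists. -/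
theorem exists_isNondegeneratePart {d : ℕ} {S : Type*} [MeasurableSpace S] (α : ℝ)
    (m : Measure S) [SigmaFinite m] (φ : FreeGroup (Fin d) → S → S)
    (c : FreeGroup (Fin d) → S → ℝ) : ∃ A, IsNondegeneratePart α m φ c A := by
  obtain ⟨D, hD, hc, h⟩ := Measure.exists_ae_subset_biUnion_countable m
    (C := {C | IsDegenerateSet α m φ c C}) (fun s hs => hs.1)
  refine ⟨(⋃₀ D)ᶜ, ?_⟩
  rw [IsNondegeneratePart, compl_compl]
  refine ⟨MeasurableSet.sUnion hc fun s hs => (hD hs).1, h, fun U _ hU => ?_⟩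
  have : ∀ᵐ x ∂m, ∀ s ∈ D, x ∈ s → x ∈ U :=
    (ae_ball_iff hc).2 fun s hs => hU s (hD hs)
  filter_upwards [this] with x hx
  rintro ⟨s, hs, hxs⟩
  exact hx s hs hxs

/-- Versions of the nondegenerate part agree up to `m`-null sets. -/
theorem IsNondegeneratePart.ae_eq {d : ℕ} {S : Type*} [MeasurableSpace S] {α : ℝ}
    {m : Measure S} {φ : FreeGroup (Fin d) → S → S} {c : FreeGroup (Fin d) → S → ℝ}
    {A A' : Set S} (h : IsNondegeneratePart α m φ c A) (h' : IsNondegeneratePart α m φ c A') :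
    A =ᵐ[m] A' :=
  ae_eq_set_compl_compl.1 <| EventuallyLE.antisymm
    (h.least _ h'.measurableSet h'.contains) (h'.least _ h.measurableSet h.contains)

/-! ### Symmetric stable fields and their partial maxima -/

/-- `(X_t)` has the same finite-dimensional distributions as `(∫ F_t dM)`, where `M` is a symmetric
`α`-stable random measure with control measure `m`. The finite-dimensional distributions of the
stable integrals are given, as usual, by their joint characteristic functions
`E exp(i ∑ θ_t ∫ F_t dM) = exp(-∫ |∑ θ_t F_t|^α dm)`. -/
structure HasStableIntegralRep {G S Ω : Type*} [MeasurableSpace S] [MeasurableSpace Ω] (α : ℝ)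
    (m : Measure S) (F : G → S → ℝ) (P : Measure Ω) (X : G → Ω → ℝ) : Prop where
  aemeasurable : ∀ t, AEMeasurable (X t) P
  charFun_eq : ∀ (T : Finset G) (θ : G → ℝ),
    ∫ ω, Complex.exp (((∑ t ∈ T, θ t * X t ω : ℝ) : ℂ) * Complex.I) ∂P
      = ((Real.exp (-∫ s, |∑ t ∈ T, θ t * F t s| ^ α ∂m) : ℝ) : ℂ)

/-- The partial maximum `M_n = max_{t ∈ E_n} |X_t|`. -/
noncomputable def partialMax {d : ℕ} {Ω : Type*} (X : FreeGroup (Fin d) → Ω → ℝ) (n : ℕ)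
    (ω : Ω) : ℝ :=
  (ball d n).sup' (ball_nonempty d n) (fun t => |X t ω|)

/-! ### The Fréchet law -/

/-- The distribution function of the standard `α`-Fréchet law: `exp(-x^{-α})` for `x > 0`, and `0`
for `x ≤ 0`. -/
noncomputable def frechetCDF (α : ℝ) (hα : 0 < α) : StieltjesFunction ℝ where
  toFun x := if 0 < x then Real.exp (-x ^ (-α)) else 0
  mono' := by
    intro x y hxy
    dsimp only
    split_ifs with hx hy hy
    · exact Real.exp_le_exp.2 (neg_le_neg (Real.rpow_le_rpow_of_nonpos hx hxy (by linarith)))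
    · exact absurd (hx.trans_le hxy) hy
    · positivity
    · exact le_rfl
  right_continuous' := by
    intro x
    rcases lt_trichotomy x 0 with hx | rfl | hx
    · refine ContinuousAt.continuousWithinAt ?_
      refine (continuousAt_const (y := (0 : ℝ))).congr ?_
      filter_upwards [Iio_mem_nhds hx] with y hy
      rw [if_neg (not_lt.2 (le_of_lt hy))]
    · rw [← continuousWithinAt_Ioi_iff_Ici]
      unfold ContinuousWithinAt
      dsimp only
      rw [if_neg (lt_irrefl (0 : ℝ))]
      have h : Tendsto (fun y : ℝ => Real.exp (-y ^ (-α))) (𝓝[>] 0) (𝓝 0) :=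
        Real.tendsto_exp_neg_atTop_nhds_zero.comp (tendsto_rpow_neg_nhdsGT_zero (by linarith))
      refine h.congr' ?_
      filter_upwards [self_mem_nhdsWithin] with y hy
      exact (if_pos hy).symm
    · refine ContinuousAt.continuousWithinAt ?_
      have h : ContinuousAt (fun y : ℝ => Real.exp (-y ^ (-α))) x :=
        (Real.continuousAt_rpow_const _ _ (Or.inl hx.ne')).neg.rexp
      refine h.congr ?_
      filter_upwards [Ioi_mem_nhds hx] with y hy
      exact (if_pos hy).symm

/-- The standard `α`-Fréchet law. -/
noncomputable def frechet (α : ℝ) (hα : 0 < α) : Measure ℝ := (frechetCDF α hα).measure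

instance instIsProbabilityMeasureFrechet (α : ℝ) (hα : 0 < α) :
    IsProbabilityMeasure (frechet α hα) := by
  refine StieltjesFunction.isProbabilityMeasure _ ?_ ?_
  · refine tendsto_const_nhds.congr' ?_
    filter_upwards [eventually_le_atBot 0] with y hy
    exact (if_neg (not_lt.2 hy)).symm
  · have h : Tendsto (fun y : ℝ => Real.exp (-y ^ (-α))) atTop (𝓝 1) := by
      have := (tendsto_rpow_neg_atTop hα).neg.rexp
      simpa using this
    refine h.congr' ?_
    filter_upwards [eventually_gt_atTop 0] with y hy
    exact (if_pos hy).symm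

end StableField

/-!
Put `g = |f|^α` and let `T_t g = d(m ∘ φ_t)/dm · g ∘ φ_t` be the transfer operators, so that
`b_n(f)^α = ∫ max_{t ∈ E_n} T_t g dm`. They preserve the integral and satisfy `T_t T_u = T_{tu}`.

*Behaviour of `b_n(f)`.* Sort the elements of `E_n` by the letters which their reduced words can
follow. As every letter is followed by `2d - 1` letters, the sum over all letters of the resulting
maximal integrals grows by a factor of at most `2d - 1` (plus a constant) when `n` increases by one,
while the number of words grows by a factor of at least `2d - 1`. Hence the quotient is essentially
nonincreasing and converges (`antitone_tailSum_div`), and `b_n(f)^α / |E_n|` either tends to zero or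
is bounded away from zero (`avgMax_dichotomy`). In the first case every function supported where
`f ≠ 0` is, up to a small error, dominated by a multiple of `f`, so that `{f ≠ 0}` is degenerate
(`tendsto_avgMax_of_support`, `exists_le_avgMax`); this is impossible if `f` charges the
nondegenerate part.

*Behaviour of `M_n`.* The vector `(X_t)_{t ∈ E_n}` is, up to the scale `b_n(f)`, the limit in
distribution of normalised sums `k^{-1/α} ∑_{i ≤ k} ξ_i` of independent copies of
`ξ = ± Z^{-1/α} V`, where `Z` is exponential and `V` is distributed as the direction
`(f_t)_t / max |f_t|` under the probability measure with density proportional to `max |f_t|^α`;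
this follows from Lévy's convergence theorem (`tendsto_integral_norm_sum`). Since the maximum norm
of `ξ` is `Z^{-1/α}`, the normalised maximum of the norms of the `ξ_i` has exactly the Fréchet law
(`map_norm_pi`). Each coordinate of `V` has the same `α`-th moment `ρ = ∫ |f|^α dm / b_n(f)^α`,
which is of order `1 / |E_n|` because `b_n(f)^α` is of order `|E_n|`. So, with high probability as
`n` grows, no coordinate receives two large contributions, by a union bound, and the small
contributions to all the coordinates are negligible, by fourth moments. The maximum of the sum is
therefore close to the largest summand, uniformly in `k` (`abs_integral_norm_sum_sub_le`). Along a
subsequence on which `b_n(f)^α / |E_n|` converges this gives the Fréchet limit.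
-/

namespace StableField

/-! ### Counting words in the free group -/

/-- The words `L` of length at most `n` which can follow the letter `x`, that is, for which
`x :: L` is reduced. The letter `(x.1, !x.2)` is the inverse of `x`. -/
def tails (d : ℕ) : ℕ → Fin d × Bool → Finset (List (Fin d × Bool))
  | 0, _ => {[]}
  | n + 1, x => insert [] ((Finset.univ.erase (x.1, !x.2)).biUnion
      fun y => (tails d n y).image (List.cons y))

theorem mem_tails {d n : ℕ} {x : Fin d × Bool} {L : List (Fin d × Bool)} :
    L ∈ tails d n x ↔ FreeGroup.IsReduced (x :: L) ∧ L.length ≤ n := by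
  induction n generalizing x L with
  | zero =>
    simp only [tails, Finset.mem_singleton, Nat.le_zero, List.length_eq_zero_iff]
    exact ⟨fun h => ⟨by rw [h]; exact FreeGroup.IsReduced.singleton, h⟩, fun h => h.2⟩
  | succ n ih =>
    rcases L with _ | ⟨y, L⟩
    · simp [tails]
    · have : y ≠ (x.1, !x.2) ↔ (x.1 = y.1 → x.2 = y.2) := by
        rcases x with ⟨i, a⟩
        rcases y with ⟨j, b⟩
        cases a <;> cases b <;> simp [Prod.ext_iff, eq_comm]
      simp [tails, ih, this]
      tauto

/-- The number of words in `tails d n x`. -/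
def numTails (d : ℕ) : ℕ → ℕ
  | 0 => 1
  | n + 1 => 1 + (2 * d - 1) * numTails d n

theorem card_tails (d n : ℕ) (x : Fin d × Bool) : (tails d n x).card = numTails d n := by
  induction n generalizing x with
  | zero => simp [tails, numTails]
  | succ n ih =>
    rw [tails, Finset.card_insert_of_notMem (by simp), Finset.card_biUnion]
    · have (y : Fin d × Bool) : ((tails d n y).image (List.cons y)).card = numTails d n := by
        rw [Finset.card_image_of_injective _ List.cons_injective, ih]
      simp only [this, Finset.sum_const, Finset.card_erase_of_mem (Finset.mem_univ _)]
      simp [numTails, mul_comm d 2, add_comm]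
    · intro y _ z _ hyz
      rw [Function.onFun, Finset.disjoint_left]
      simp only [Finset.mem_image, not_exists, not_and]
      rintro _ ⟨L, _, rfl⟩ L' _ h
      exact hyz (List.cons.inj h).1.symm

theorem ball_eq_biUnion_tails {d : ℕ} (hd : 0 < d) (n : ℕ) :
    ball d n = Finset.univ.biUnion fun x => (tails d n x).image FreeGroup.mk := by
  ext t
  simp only [ball, Set.Finite.mem_toFinset, Set.mem_ofPred_eq, Finset.mem_biUnion, Finset.mem_univ,
    true_and, Finset.mem_image, mem_tails]
  constructor
  · intro ht
    have hr : FreeGroup.IsReduced t.toWord := FreeGroup.isReduced_toWord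
    -- a nonempty word can follow its own first letter
    rcases hL : t.toWord with _ | ⟨y, L⟩
    · refine ⟨(⟨0, hd⟩, true), [], ⟨FreeGroup.IsReduced.singleton, by simp⟩, ?_⟩
      rw [← hL, FreeGroup.mk_toWord]
    · refine ⟨y, y :: L, ⟨?_, ?_⟩, ?_⟩
      · rw [FreeGroup.isReduced_cons_cons, ← hL]
        exact ⟨fun _ => rfl, hr⟩
      · rw [← hL]; exact ht
      · rw [← hL, FreeGroup.mk_toWord]
  · rintro ⟨x, L, ⟨-, hL⟩, rfl⟩
    exact FreeGroup.norm_mk_le.trans hL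

theorem numTails_le_card_ball {d : ℕ} (hd : 0 < d) (n : ℕ) : numTails d n ≤ (ball d n).card := by
  set x : Fin d × Bool := (⟨0, hd⟩, true)
  rw [← card_tails d n x, ball_eq_biUnion_tails hd]
  calc (tails d n x).card = ((tails d n x).image FreeGroup.mk).card := by
        refine (Finset.card_image_of_injOn fun L hL L' hL' h => ?_).symm
        have hred {K} (hK : K ∈ tails d n x) : FreeGroup.reduce K = K :=
          ((mem_tails.1 hK).1.infix ⟨[x], [], by simp⟩).reduce_eq
        have := congrArg FreeGroup.toWord h
        simpa [FreeGroup.toWord_mk, hred hL, hred hL'] using this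
    _ ≤ _ := Finset.card_le_card
        (Finset.subset_biUnion_of_mem (fun x => (tails d n x).image FreeGroup.mk)
          (Finset.mem_univ x))

theorem card_ball_le {d : ℕ} (hd : 0 < d) (n : ℕ) :
    (ball d n).card ≤ 2 * d * numTails d n := by
  rw [ball_eq_biUnion_tails hd]
  refine Finset.card_biUnion_le.trans ((Finset.sum_le_sum fun x _ =>
    Finset.card_image_le.trans (card_tails d n x).le).trans ?_)
  simp [mul_comm d 2]

theorem lt_numTails {d : ℕ} (hd : 0 < d) (n : ℕ) : n < numTails d n := by
  induction n with
  | zero => simp [numTails]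
  | succ n ih =>
    rw [numTails]
    have : 1 * numTails d n ≤ (2 * d - 1) * numTails d n := Nat.mul_le_mul_right _ (by omega)
    omega

theorem tendsto_card_ball {d : ℕ} (hd : 0 < d) :
    Tendsto (fun n => ((ball d n).card : ℝ)) atTop atTop :=
  tendsto_natCast_atTop_atTop.comp <| tendsto_atTop_mono
    (fun n => (lt_numTails hd n).le.trans (numTails_le_card_ball hd n)) tendsto_id

theorem card_ball_pos (d n : ℕ) : (0 : ℝ) < (ball d n).card := by
  exact_mod_cast (ball_nonempty d n).card_pos

/-! ### The transfer operators of a nonsingular action -/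

section Transfer

variable {G S : Type*} [Group G] [MeasurableSpace S] {m : Measure S} {φ : G → S → S}

theorem IsNonsingularAction.comp_inv (h : IsNonsingularAction m φ) (t : G) (s : S) :
    φ t (φ t⁻¹ s) = s := by
  have := congrFun (h.map_mul t⁻¹ t) s
  simpa [h.map_one] using this.symm

theorem IsNonsingularAction.inv_comp (h : IsNonsingularAction m φ) (t : G) (s : S) :
    φ t⁻¹ (φ t s) = s := by
  simpa using h.comp_inv t⁻¹ s

theorem IsNonsingularAction.sigmaFinite (h : IsNonsingularAction m φ) [SigmaFinite m] (t : G) :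
    SigmaFinite (compMeasure m φ t) :=
  MeasurableEquiv.sigmaFinite_map (μ := m)
    ⟨⟨φ t⁻¹, φ t, h.comp_inv t, h.inv_comp t⟩, h.measurable _, h.measurable _⟩

theorem IsNonsingularAction.quasiMeasurePreserving (h : IsNonsingularAction m φ) (t : G) :
    Measure.QuasiMeasurePreserving (φ t) m m :=
  ⟨h.measurable t, by simpa [compMeasure] using h.ac t⁻¹⟩

/-- The transfer operator `g ↦ d(m ∘ φ_t)/dm · g ∘ φ_t`, which preserves the integral of
nonnegative functions. -/
noncomputable def transfer (m : Measure S) (φ : G → S → S) (t : G) (g : S → ENNReal) (s : S) :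
    ENNReal :=
  (compMeasure m φ t).rnDeriv m s * g (φ t s)

theorem measurable_transfer (h : IsNonsingularAction m φ) (t : G) {g : S → ENNReal}
    (hg : Measurable g) : Measurable (transfer m φ t g) :=
  (Measure.measurable_rnDeriv _ _).mul (hg.comp (h.measurable t))

theorem lintegral_transfer (h : IsNonsingularAction m φ) [SigmaFinite m] (t : G)
    {g : S → ENNReal} (hg : Measurable g) : ∫⁻ s, transfer m φ t g s ∂m = ∫⁻ s, g s ∂m := by
  have := h.sigmaFinite t
  have hg' : Measurable fun s => g (φ t s) := hg.comp (h.measurable t)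
  unfold transfer
  rw [lintegral_rnDeriv_mul (h.ac t) hg'.aemeasurable,
    compMeasure, lintegral_map hg' (h.measurable _)]
  simp [h.comp_inv]

/-- The cocycle identity for the Radon-Nikodym derivatives. -/
theorem rnDeriv_mul (h : IsNonsingularAction m φ) [SigmaFinite m] (t u : G) :
    (compMeasure m φ (t * u)).rnDeriv m =ᵐ[m]
      transfer m φ t ((compMeasure m φ u).rnDeriv m) := by
  have := h.sigmaFinite t
  have := h.sigmaFinite u
  have hm := measurable_transfer h t (Measure.measurable_rnDeriv (compMeasure m φ u) m)
  suffices compMeasure m φ (t * u)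
      = m.withDensity (transfer m φ t ((compMeasure m φ u).rnDeriv m)) by
    rw [this]
    exact Measure.rnDeriv_withDensity m hm
  ext A hA
  rw [withDensity_apply _ hA, ← lintegral_indicator hA]
  have key : A.indicator (transfer m φ t ((compMeasure m φ u).rnDeriv m))
      = transfer m φ t (((φ t⁻¹) ⁻¹' A).indicator ((compMeasure m φ u).rnDeriv m)) := by
    ext s
    by_cases hs : s ∈ A <;> simp [transfer, Set.indicator, hs, h.inv_comp]
  rw [key, lintegral_transfer h t ((Measure.measurable_rnDeriv _ _).indicator (h.measurable _ hA)),
    lintegral_indicator (h.measurable _ hA), Measure.setLIntegral_rnDeriv (h.ac u), compMeasure,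
    compMeasure, Measure.map_apply (h.measurable _) hA,
    Measure.map_apply (h.measurable _) (h.measurable _ hA), mul_inv_rev, h.map_mul,
    Set.preimage_comp]

theorem transfer_mul (h : IsNonsingularAction m φ) [SigmaFinite m] (t u : G) (g : S → ENNReal) :
    transfer m φ (t * u) g =ᵐ[m] transfer m φ t (transfer m φ u g) := by
  filter_upwards [rnDeriv_mul h t u] with s hs
  simp only [transfer] at hs ⊢
  rw [hs, h.map_mul, Function.comp_apply, mul_assoc]

theorem transfer_mono (t : G) {g g' : S → ENNReal} (hg : g ≤ g') :
    transfer m φ t g ≤ transfer m φ t g' := fun _ => mul_le_mul_right (hg _) _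

theorem transfer_add (t : G) (g g' : S → ENNReal) (s : S) :
    transfer m φ t (g + g') s = transfer m φ t g s + transfer m φ t g' s := by
  simp [transfer, mul_add]

theorem transfer_const_mul (t : G) (K : ENNReal) (g : S → ENNReal) (s : S) :
    transfer m φ t (fun s => K * g s) s = K * transfer m φ t g s := by
  simp [transfer, mul_left_comm]

theorem transfer_sup {ι : Type*} (t : G) (I : Finset ι) (F : ι → S → ENNReal) (s : S) :
    transfer m φ t (fun s => I.sup fun i => F i s) s = I.sup fun i => transfer m φ t (F i) s := by
  unfold transfer
  exact Finset.apply_sup_eq_sup_comp_of_linearOrder (fun x => _ * x)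
    (fun _ _ h => mul_le_mul_right h _) (by simp)

/-- The integral of the maximal function `max_{t ∈ I} T_t g` of the transfer operators `T_t`. -/
noncomputable def maxIntegral {ι : Type*} (m : Measure S) (φ : G → S → S) (g : S → ENNReal)
    (I : Finset ι) (e : ι → G) : ENNReal :=
  ∫⁻ s, I.sup (fun i => transfer m φ (e i) g s) ∂m

theorem measurable_sup_transfer {ι : Type*} (h : IsNonsingularAction m φ) {g : S → ENNReal}
    (hg : Measurable g) (I : Finset ι) (e : ι → G) :
    Measurable fun s => I.sup (fun i => transfer m φ (e i) g s) := by
  simp only [Finset.sup_eq_iSup]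
  exact .biSup (I : Set ι) I.countable_toSet fun i _ => measurable_transfer h (e i) hg

theorem maxIntegral_le_card_mul {ι : Type*} (h : IsNonsingularAction m φ) [SigmaFinite m]
    {g : S → ENNReal} (hg : Measurable g) (I : Finset ι) (e : ι → G) :
    maxIntegral m φ g I e ≤ I.card * ∫⁻ s, g s ∂m := by
  calc maxIntegral m φ g I e ≤ ∫⁻ s, ∑ i ∈ I, transfer m φ (e i) g s ∂m :=
        lintegral_mono fun s => Finset.sup_le fun i hi =>
          Finset.single_le_sum (f := fun i => transfer m φ (e i) g s) (fun _ _ => zero_le) hi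
    _ = I.card * ∫⁻ s, g s ∂m := by
        rw [lintegral_finsetSum _ fun i _ => measurable_transfer h (e i) hg]
        simp [lintegral_transfer h _ hg]

theorem maxIntegral_mul_left {ι : Type*} (h : IsNonsingularAction m φ) [SigmaFinite m]
    {g : S → ENNReal} (hg : Measurable g) (I : Finset ι) (e : ι → G) (t : G) :
    maxIntegral m φ g I (fun i => t * e i) = maxIntegral m φ g I e := by
  have h1 : ∀ᵐ s ∂m, ∀ i ∈ I,
      transfer m φ (t * e i) g s = transfer m φ t (transfer m φ (e i) g) s :=
    (ae_ball_iff I.countable_toSet).2 fun i _ => transfer_mul h t (e i) g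
  calc maxIntegral m φ g I (fun i => t * e i)
      = ∫⁻ s, transfer m φ t (fun s => I.sup fun i => transfer m φ (e i) g s) s ∂m := by
        refine lintegral_congr_ae ?_
        filter_upwards [h1] with s hs
        rw [transfer_sup]
        exact Finset.sup_congr rfl hs
    _ = maxIntegral m φ g I e := lintegral_transfer h t (measurable_sup_transfer h hg I e)

theorem maxIntegral_add_le {ι : Type*} (h : IsNonsingularAction m φ) {g g' : S → ENNReal}
    (hg : Measurable g) (I : Finset ι) (e : ι → G) :
    maxIntegral m φ (g + g') I e ≤ maxIntegral m φ g I e + maxIntegral m φ g' I e := by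
  unfold maxIntegral
  rw [← lintegral_add_left (measurable_sup_transfer h hg I e)]
  refine lintegral_mono fun s => Finset.sup_le fun i hi => ?_
  rw [transfer_add]
  exact add_le_add (Finset.le_sup (f := fun i => transfer m φ (e i) g s) hi)
    (Finset.le_sup (f := fun i => transfer m φ (e i) g' s) hi)

theorem maxIntegral_const_mul {ι : Type*} (h : IsNonsingularAction m φ) {g : S → ENNReal}
    (hg : Measurable g) (K : ENNReal) (I : Finset ι) (e : ι → G) :
    maxIntegral m φ (fun s => K * g s) I e = K * maxIntegral m φ g I e := by
  unfold maxIntegral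
  rw [← lintegral_const_mul _ (measurable_sup_transfer h hg I e)]
  refine lintegral_congr fun s => ?_
  rw [Finset.apply_sup_eq_sup_comp_of_linearOrder (fun x => K * x)
    (fun _ _ h => mul_le_mul_right h _) (by simp)]
  simp [transfer_const_mul, Function.comp_def]

theorem maxIntegral_mono {ι : Type*} {g g' : S → ENNReal} (hg : g ≤ g') (I : Finset ι)
    (e : ι → G) : maxIntegral m φ g I e ≤ maxIntegral m φ g' I e :=
  lintegral_mono fun s => Finset.sup_mono_fun fun i _ => transfer_mono (e i) hg s

end Transfer

/-! ### Growth of the maximal functions along balls -/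

section Growth

variable {d : ℕ} {S : Type*} [MeasurableSpace S] {m : Measure S}
  {φ : FreeGroup (Fin d) → S → S}

/-- The sum over all letters `x` of the integral of the maximal function over the group elements
given by `tails d n x`. -/
noncomputable def tailSum (m : Measure S) (φ : FreeGroup (Fin d) → S → S) (g : S → ENNReal)
    (n : ℕ) : ENNReal :=
  ∑ x, maxIntegral m φ g (tails d n x) FreeGroup.mk

theorem maxIntegral_tails_succ_le (h : IsNonsingularAction m φ) [SigmaFinite m]
    {g : S → ENNReal} (hg : Measurable g) (n : ℕ) (x : Fin d × Bool) :
    maxIntegral m φ g (tails d (n + 1) x) FreeGroup.mk ≤ ∫⁻ s, g s ∂m +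
      ∑ y ∈ Finset.univ.erase (x.1, !x.2), maxIntegral m φ g (tails d n y) FreeGroup.mk := by
  set Y := Finset.univ.erase (x.1, !x.2)
  have hm (y : Fin d × Bool) := measurable_sup_transfer h hg (tails d n y)
    fun L => FreeGroup.mk [y] * FreeGroup.mk L
  have hcons (y : Fin d × Bool) (L) :
      FreeGroup.mk (y :: L) = FreeGroup.mk [y] * FreeGroup.mk L := by
    rw [FreeGroup.mul_mk, List.singleton_append]
  calc maxIntegral m φ g (tails d (n + 1) x) FreeGroup.mk
      ≤ ∫⁻ s, (transfer m φ (FreeGroup.mk []) g s + ∑ y ∈ Y, (tails d n y).sup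
          fun L => transfer m φ (FreeGroup.mk [y] * FreeGroup.mk L) g s) ∂m := by
        refine lintegral_mono fun s => Finset.sup_le fun L hL => ?_
        simp only [tails, Finset.mem_insert, Finset.mem_biUnion, Finset.mem_image] at hL
        rcases hL with rfl | ⟨y, hy, L, hL, rfl⟩
        · exact le_self_add
        · refine le_add_left (le_trans ?_ (Finset.single_le_sum
            (f := fun y => (tails d n y).sup
              fun L => transfer m φ (FreeGroup.mk [y] * FreeGroup.mk L) g s)
              (fun _ _ => zero_le) hy))
          rw [hcons]
          exact Finset.le_sup
            (f := fun L => transfer m φ (FreeGroup.mk [y] * FreeGroup.mk L) g s) hL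
    _ = _ := by
        rw [lintegral_add_left (measurable_transfer h _ hg), lintegral_transfer h _ hg,
          lintegral_finsetSum _ fun y _ => hm y]
        congr 1
        exact Finset.sum_congr rfl fun y _ => maxIntegral_mul_left h hg _ _ _

/-- A word with first letter `y` follows exactly `2d - 1` letters, so that the maximal integrals
grow by a factor of at most `2d - 1`, up to an additive constant. -/
theorem tailSum_succ_le (h : IsNonsingularAction m φ) [SigmaFinite m]
    {g : S → ENNReal} (hg : Measurable g) (n : ℕ) :
    tailSum m φ g (n + 1) ≤ (2 * d : ℕ) * ∫⁻ s, g s ∂m + (2 * d - 1 : ℕ) * tailSum m φ g n := by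
  refine (Finset.sum_le_sum fun x _ => maxIntegral_tails_succ_le h hg n x).trans ?_
  rw [Finset.sum_add_distrib]
  refine add_le_add (by simp [mul_comm d 2]) (le_of_eq ?_)
  calc ∑ x : Fin d × Bool, ∑ y ∈ Finset.univ.erase (x.1, !x.2),
        maxIntegral m φ g (tails d n y) FreeGroup.mk
      = ∑ y : Fin d × Bool, ∑ x ∈ Finset.univ.erase (y.1, !y.2),
        maxIntegral m φ g (tails d n y) FreeGroup.mk := by
        refine Finset.sum_comm' fun x y => ?_
        rcases x with ⟨i, a⟩
        rcases y with ⟨j, b⟩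
        cases a <;> cases b <;> simp [Prod.ext_iff, eq_comm]
    _ = _ := by
        simp [tailSum, Finset.mul_sum, Finset.card_erase_of_mem, mul_comm d 2]

theorem tailSum_ne_top (h : IsNonsingularAction m φ) [SigmaFinite m]
    {g : S → ENNReal} (hg : Measurable g) (hgi : ∫⁻ s, g s ∂m ≠ ⊤) (n : ℕ) :
    tailSum m φ g n ≠ ⊤ :=
  ENNReal.sum_ne_top.2 fun _ _ => ne_top_of_le_ne_top
    (ENNReal.mul_ne_top (ENNReal.natCast_ne_top _) hgi) (maxIntegral_le_card_mul h hg _ _)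

theorem maxIntegral_ball_le_tailSum (hd : 0 < d) (h : IsNonsingularAction m φ)
    {g : S → ENNReal} (hg : Measurable g) (n : ℕ) :
    maxIntegral m φ g (ball d n) id ≤ tailSum m φ g n := by
  unfold tailSum maxIntegral
  rw [← lintegral_finsetSum _ fun x _ => measurable_sup_transfer h hg _ _]
  refine lintegral_mono fun s => Finset.sup_le fun t ht => ?_
  rw [ball_eq_biUnion_tails hd] at ht
  simp only [Finset.mem_biUnion, Finset.mem_univ, true_and, Finset.mem_image] at ht
  obtain ⟨x, L, hL, rfl⟩ := ht
  exact (Finset.le_sup (f := fun L => transfer m φ (FreeGroup.mk L) g s) hL).trans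
    (Finset.single_le_sum (f := fun x => (tails d n x).sup
      fun L => transfer m φ (FreeGroup.mk L) g s) (fun _ _ => zero_le) (Finset.mem_univ x))

theorem tailSum_le_mul_maxIntegral_ball (hd : 0 < d) (g : S → ENNReal) (n : ℕ) :
    tailSum m φ g n ≤ (2 * d : ℕ) * maxIntegral m φ g (ball d n) id := by
  calc tailSum m φ g n ≤ ∑ _x : Fin d × Bool, maxIntegral m φ g (ball d n) id := by
        refine Finset.sum_le_sum fun x _ => lintegral_mono fun s => Finset.sup_le fun L hL => ?_
        refine Finset.le_sup (f := fun t => transfer m φ (id t) g s) ?_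
        rw [ball_eq_biUnion_tails hd]
        exact Finset.mem_biUnion.2 ⟨x, Finset.mem_univ x, Finset.mem_image_of_mem _ hL⟩
    _ = _ := by simp [mul_comm d 2]

/-- The average of the maximal function of `g` over the ball `E_n`. -/
noncomputable def avgMax (m : Measure S) (φ : FreeGroup (Fin d) → S → S) (g : S → ENNReal)
    (n : ℕ) : ℝ :=
  (maxIntegral m φ g (ball d n) id).toReal / (ball d n).card

theorem avgMax_nonneg (g : S → ENNReal) (n : ℕ) : 0 ≤ avgMax m φ g n := by
  unfold avgMax; positivity

theorem maxIntegral_ball_ne_top (h : IsNonsingularAction m φ) [SigmaFinite m]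
    {g : S → ENNReal} (hg : Measurable g) (hgi : ∫⁻ s, g s ∂m ≠ ⊤) (n : ℕ) :
    maxIntegral m φ g (ball d n) id ≠ ⊤ :=
  ne_top_of_le_ne_top (ENNReal.mul_ne_top (ENNReal.natCast_ne_top _) hgi)
    (maxIntegral_le_card_mul h hg _ _)

theorem avgMax_le (h : IsNonsingularAction m φ) [SigmaFinite m]
    {g : S → ENNReal} (hg : Measurable g) (hgi : ∫⁻ s, g s ∂m ≠ ⊤) (n : ℕ) :
    avgMax m φ g n ≤ (∫⁻ s, g s ∂m).toReal := by
  rw [avgMax, div_le_iff₀ (card_ball_pos d n), mul_comm]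
  refine (ENNReal.toReal_mono (ENNReal.mul_ne_top (ENNReal.natCast_ne_top _) hgi)
    (maxIntegral_le_card_mul h hg _ _)).trans ?_
  simp

/-- With `D = 2d ∫ g`, the quotient of `tailSum + D` by the number of words is nonincreasing. This
is where the tree structure of the free group enters. -/
theorem antitone_tailSum_div (hd : 2 ≤ d) (h : IsNonsingularAction m φ) [SigmaFinite m]
    {g : S → ENNReal} (hg : Measurable g) (hgi : ∫⁻ s, g s ∂m ≠ ⊤) :
    Antitone fun n => ((tailSum m φ g n).toReal + 2 * d * (∫⁻ s, g s ∂m).toReal)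
      / (numTails d n : ℝ) := by
  refine antitone_nat_of_succ_le fun n => ?_
  have hc (n) : (0 : ℝ) < numTails d n := by
    exact_mod_cast (Nat.zero_le n).trans_lt (lt_numTails (by omega) n)
  rw [div_le_div_iff₀ (hc _) (hc _)]
  set I := (∫⁻ s, g s ∂m).toReal with hI
  have hI0 : 0 ≤ I := ENNReal.toReal_nonneg
  have hD : (4 : ℝ) ≤ 2 * d := by exact_mod_cast (by omega : 4 ≤ 2 * d)
  have hq : ((2 * d - 1 : ℕ) : ℝ) = 2 * d - 1 := by
    rw [Nat.cast_sub (by omega)]; simp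
  have h1 : (tailSum m φ g (n + 1)).toReal ≤
      2 * d * I + (2 * d - 1) * (tailSum m φ g n).toReal := by
    have hfin1 : ((2 * d : ℕ) : ENNReal) * ∫⁻ s, g s ∂m ≠ ⊤ :=
      ENNReal.mul_ne_top (ENNReal.natCast_ne_top _) hgi
    have hfin2 : ((2 * d - 1 : ℕ) : ENNReal) * tailSum m φ g n ≠ ⊤ :=
      ENNReal.mul_ne_top (ENNReal.natCast_ne_top _) (tailSum_ne_top h hg hgi n)
    have := ENNReal.toReal_mono (ENNReal.add_ne_top.2 ⟨hfin1, hfin2⟩)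
      (tailSum_succ_le h hg n)
    rw [ENNReal.toReal_add hfin1 hfin2, ENNReal.toReal_mul, ENNReal.toReal_mul,
      ENNReal.toReal_natCast, ENNReal.toReal_natCast, hq, ← hI] at this
    simpa using this
  have h2 : (numTails d (n + 1) : ℝ) = 1 + (2 * d - 1) * numTails d n := by
    rw [numTails, Nat.cast_add, Nat.cast_mul, hq, Nat.cast_one]
  have ht : 0 ≤ (tailSum m φ g n).toReal := ENNReal.toReal_nonneg
  rw [h2]
  set u := (tailSum m φ g n).toReal
  set D := (2 * d : ℝ)
  have h3 : (tailSum m φ g (n + 1)).toReal + D * I ≤ (D - 1) * (u + D * I) := by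
    nlinarith [mul_nonneg (by linarith : (0 : ℝ) ≤ D) hI0]
  have h4 : 0 ≤ u + D * I := by positivity
  nlinarith [mul_le_mul_of_nonneg_right h3 (hc n).le]

/-- Either the averages of the maximal function tend to zero, or they are bounded away from
zero. -/
theorem avgMax_dichotomy (hd : 2 ≤ d) (h : IsNonsingularAction m φ) [SigmaFinite m]
    {g : S → ENNReal} (hg : Measurable g) (hgi : ∫⁻ s, g s ∂m ≠ ⊤) :
    Tendsto (avgMax m φ g) atTop (𝓝 0) ∨ ∃ ε > 0, ∀ᶠ n in atTop, ε ≤ avgMax m φ g n := by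
  have hd0 : 0 < d := by omega
  have hdR : (0 : ℝ) < 2 * d := by positivity
  have hc (n) : (0 : ℝ) < numTails d n := by
    exact_mod_cast (Nat.zero_le n).trans_lt (lt_numTails hd0 n)
  set D := 2 * d * (∫⁻ s, g s ∂m).toReal
  have hanti := antitone_tailSum_div hd h hg hgi
  have hbdd : BddBelow (Set.range fun n => ((tailSum m φ g n).toReal + D) / (numTails d n : ℝ)) :=
    ⟨0, by rintro _ ⟨n, rfl⟩; positivity⟩
  have hlim := tendsto_atTop_ciInf hanti hbdd
  set l := ⨅ n, ((tailSum m φ g n).toReal + D) / (numTails d n : ℝ)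
  have hD : Tendsto (fun n => D / (numTails d n : ℝ)) atTop (𝓝 0) :=
    tendsto_const_nhds.div_atTop <| tendsto_natCast_atTop_atTop.comp <|
      tendsto_atTop_mono (fun n => (lt_numTails hd0 n).le) tendsto_id
  have hlim' : Tendsto (fun n => (tailSum m φ g n).toReal / (numTails d n : ℝ)) atTop (𝓝 l) := by
    have := hlim.sub hD
    rw [sub_zero] at this
    refine this.congr fun n => ?_
    rw [← sub_div]
    exact congrArg (· / _) (add_sub_cancel_right _ D)
  have hl0 : 0 ≤ l := ge_of_tendsto' hlim' fun n => by positivity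
  have htop := tailSum_ne_top h hg hgi
  have hmtop := maxIntegral_ball_ne_top h hg hgi
  rcases hl0.eq_or_lt with hl | hl
  · left
    rw [← hl] at hlim'
    refine squeeze_zero (avgMax_nonneg g) (fun n => ?_) hlim'
    exact div_le_div₀ ENNReal.toReal_nonneg
      (ENNReal.toReal_mono (htop n) (maxIntegral_ball_le_tailSum hd0 h hg n)) (hc n)
      (by exact_mod_cast numTails_le_card_ball hd0 n)
  · right
    refine ⟨l / 2 / (2 * d) / (2 * d), by positivity, ?_⟩
    filter_upwards [hlim'.eventually (lt_mem_nhds (half_lt_self hl))] with n hn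
    have h1 : (tailSum m φ g n).toReal ≤ 2 * d * (maxIntegral m φ g (ball d n) id).toReal := by
      have := ENNReal.toReal_mono (ENNReal.mul_ne_top (ENNReal.natCast_ne_top _) (hmtop n))
        (tailSum_le_mul_maxIntegral_ball hd0 g n)
      simpa using this
    have h2 : ((ball d n).card : ℝ) ≤ 2 * d * numTails d n := by
      exact_mod_cast card_ball_le hd0 n
    rw [avgMax, div_div, div_le_div_iff₀ (by positivity) (card_ball_pos d n)]
    rw [lt_div_iff₀ (hc n)] at hn
    nlinarith [mul_le_mul_of_nonneg_left h2 (half_pos hl).le]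

/-- If the averages for `g` tend to zero, so do those for every integrable function which vanishes
where `g` does, because it is dominated by a multiple of `g` up to an error of small integral. -/
theorem tendsto_avgMax_of_support (h : IsNonsingularAction m φ) [SigmaFinite m]
    {g g' : S → ENNReal} (hg : Measurable g) (hgi : ∫⁻ s, g s ∂m ≠ ⊤)
    (hg' : Measurable g') (hgi' : ∫⁻ s, g' s ∂m ≠ ⊤) (hsupp : ∀ᵐ s ∂m, g s = 0 → g' s = 0)
    (hlim : Tendsto (avgMax m φ g) atTop (𝓝 0)) : Tendsto (avgMax m φ g') atTop (𝓝 0) := by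
  have hK : Tendsto (fun K : ℕ => ∫⁻ s, (g' s - K * g s) ∂m) atTop (𝓝 0) := by
    have : (0 : ENNReal) = ∫⁻ _, 0 ∂m := by simp
    rw [this]
    refine tendsto_lintegral_of_dominated_convergence g'
      (fun K => hg'.sub (hg.const_mul _)) (fun K => .of_forall fun s => tsub_le_self) hgi' ?_
    filter_upwards [hsupp, ae_lt_top hg' hgi'] with s hs hfin
    by_cases h0 : g s = 0
    · simp [hs h0]
    · obtain ⟨K₀, hK₀⟩ := ENNReal.exists_nat_mul_gt h0 hfin.ne
      refine tendsto_const_nhds.congr' ?_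
      filter_upwards [eventually_ge_atTop K₀] with K hK
      refine (tsub_eq_zero_of_le (hK₀.le.trans ?_)).symm
      gcongr
  have hbound (K n : ℕ) :
      avgMax m φ g' n ≤ K * avgMax m φ g n + (∫⁻ s, (g' s - K * g s) ∂m).toReal := by
    have hm : Measurable fun s => g' s - K * g s := hg'.sub (hg.const_mul _)
    have hr : ∫⁻ s, (g' s - K * g s) ∂m ≠ ⊤ :=
      ne_top_of_le_ne_top hgi' (lintegral_mono fun s => tsub_le_self)
    have h1 := (maxIntegral_mono (m := m) (φ := φ) (g := g')
      (g' := (fun s => K * g s) + fun s => g' s - K * g s) (fun s => le_add_tsub) (ball d n)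
      id).trans (maxIntegral_add_le h (hg.const_mul _) _ _)
    rw [maxIntegral_const_mul h hg] at h1
    have hf1 := ENNReal.mul_ne_top (ENNReal.natCast_ne_top K) (maxIntegral_ball_ne_top h hg hgi n)
    have hf2 := maxIntegral_ball_ne_top (d := d) h hm hr n
    have h2 := ENNReal.toReal_mono (ENNReal.add_ne_top.2 ⟨hf1, hf2⟩) h1
    rw [ENNReal.toReal_add hf1 hf2, ENNReal.toReal_mul, ENNReal.toReal_natCast] at h2
    have h3 := avgMax_le (d := d) h hm hr n
    refine le_trans ?_ (add_le_add_right h3 _)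
    unfold avgMax
    rw [← mul_div_assoc, ← add_div]
    exact div_le_div_of_nonneg_right h2 (card_ball_pos d n).le
  rw [Metric.tendsto_atTop]
  intro ε hε
  have hK' : Tendsto (fun K : ℕ => (∫⁻ s, (g' s - K * g s) ∂m).toReal) atTop (𝓝 0) := by
    have := (ENNReal.tendsto_toReal ENNReal.zero_ne_top).comp hK
    rwa [ENNReal.toReal_zero] at this
  obtain ⟨K, hKε⟩ := (hK'.eventually (gt_mem_nhds (half_pos hε))).exists
  have h0 : Tendsto (fun n => (K : ℝ) * avgMax m φ g n) atTop (𝓝 0) := by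
    simpa using hlim.const_mul (K : ℝ)
  obtain ⟨N, hN⟩ := eventually_atTop.1 (h0.eventually (gt_mem_nhds (half_pos hε)))
  refine ⟨N, fun n hn => ?_⟩
  rw [Real.dist_0_eq_abs, abs_of_nonneg (avgMax_nonneg _ _)]
  linarith [hbound K n, hN n hn]

end Growth

/-! ### The kernels and their maximal functions -/

theorem norm_restrict_eq_sup' {G : Type*} (A : Finset G) (hA : A.Nonempty) (x : G → ℝ) :
    ‖fun t : A => x t‖ = A.sup' hA fun t => |x t| := by
  refine le_antisymm ?_ (Finset.sup'_le _ _ fun t ht => norm_le_pi_norm (fun t : A => x t) ⟨t, ht⟩)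
  obtain ⟨t₀, ht₀⟩ := hA
  exact (pi_norm_le_iff_of_nonneg ((abs_nonneg (x t₀)).trans
    (Finset.le_sup' (fun t => |x t|) ht₀))).2 fun t => Finset.le_sup' (fun t => |x t|) t.2

theorem sup'_abs_rpow {G : Type*} {α : ℝ} (hα : 0 < α) (A : Finset G) (hA : A.Nonempty)
    (x : G → ℝ) : (A.sup' hA fun t => |x t| ^ α) = ‖fun t : A => x t‖ ^ α := by
  rw [norm_restrict_eq_sup' A hA]
  refine le_antisymm (Finset.sup'_le _ _ fun t ht => Real.rpow_le_rpow (abs_nonneg _)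
    (Finset.le_sup' (fun t => |x t|) ht) hα.le) ?_
  obtain ⟨t, ht, h⟩ := Finset.exists_mem_eq_sup' hA fun t => |x t|
  rw [h]
  exact Finset.le_sup' (fun t => |x t| ^ α) ht

theorem enorm_restrict_rpow {G : Type*} {α : ℝ} (hα : 0 < α) (A : Finset G) (hA : A.Nonempty)
    (x : G → ℝ) : ‖fun t : A => x t‖ₑ ^ α = A.sup fun t => ‖x t‖ₑ ^ α := by
  refine le_antisymm ?_ (Finset.sup_le fun t ht => ENNReal.rpow_le_rpow ?_ hα.le)
  · obtain ⟨t, ht, h⟩ := Finset.exists_mem_eq_sup' hA fun t => |x t|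
    rw [← norm_restrict_eq_sup'] at h
    have : ‖fun t : A => x t‖ₑ = ‖x t‖ₑ := by
      rw [← ofReal_norm, ← ofReal_norm, h, Real.norm_eq_abs]
    rw [this]
    exact Finset.le_sup (f := fun t => ‖x t‖ₑ ^ α) ht
  · rw [← ofReal_norm, ← ofReal_norm]
    exact ENNReal.ofReal_le_ofReal (norm_le_pi_norm (fun t : A => x t) ⟨t, ht⟩)

section Kernel

variable {G S : Type*} [Group G] [MeasurableSpace S] {m : Measure S}
  {φ : G → S → S} {α : ℝ} {c : G → S → ℝ}

theorem measurable_kernel (h : IsNonsingularAction m φ) (hcm : ∀ t, Measurable (c t)) {f : S → ℝ}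
    (hf : Measurable f) (t : G) : Measurable (kernel α m φ c f t) :=
  ((hcm t).mul ((Measure.measurable_rnDeriv _ _).ennreal_toReal.pow_const _)).mul
    (hf.comp (h.measurable t))

theorem enorm_kernel_rpow [SigmaFinite m] (h : IsNonsingularAction m φ) (hα : 0 < α)
    (hc : ∀ t s, c t s = 1 ∨ c t s = -1) (f : S → ℝ) (t : G) :
    ∀ᵐ s ∂m, ‖kernel α m φ c f t s‖ₑ ^ α = transfer m φ t (fun s => ‖f s‖ₑ ^ α) s := by
  have := h.sigmaFinite t
  filter_upwards [Measure.rnDeriv_lt_top (compMeasure m φ t) m] with s hs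
  have h1 : ‖c t s‖ₑ = 1 := by
    rcases hc t s with h | h <;> simp [h]
  have h2 : ‖((compMeasure m φ t).rnDeriv m s).toReal ^ (1 / α)‖ₑ ^ α
      = (compMeasure m φ t).rnDeriv m s := by
    rw [Real.enorm_eq_ofReal (by positivity),
      ← ENNReal.ofReal_rpow_of_nonneg ENNReal.toReal_nonneg (by positivity),
      ENNReal.ofReal_toReal hs.ne, ← ENNReal.rpow_mul, one_div_mul_cancel hα.ne', ENNReal.rpow_one]
  rw [kernel, enorm_mul, enorm_mul, h1, one_mul, ENNReal.mul_rpow_of_nonneg _ _ hα.le, h2, transfer]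

theorem lintegral_enorm_kernel_rpow [SigmaFinite m] (h : IsNonsingularAction m φ) (hα : 0 < α)
    (hc : ∀ t s, c t s = 1 ∨ c t s = -1) {f : S → ℝ} (hf : Measurable f) (t : G) :
    ∫⁻ s, ‖kernel α m φ c f t s‖ₑ ^ α ∂m = ∫⁻ s, ‖f s‖ₑ ^ α ∂m := by
  rw [lintegral_congr_ae (enorm_kernel_rpow h hα hc f t),
    lintegral_transfer h t (hf.enorm.pow_const _)]

theorem lintegral_enorm_restrict_kernel [SigmaFinite m] (h : IsNonsingularAction m φ) (hα : 0 < α)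
    (hc : ∀ t s, c t s = 1 ∨ c t s = -1) (f : S → ℝ) (A : Finset G) (hA : A.Nonempty) :
    ∫⁻ s, ‖fun t : A => kernel α m φ c f t s‖ₑ ^ α ∂m
      = maxIntegral m φ (fun s => ‖f s‖ₑ ^ α) A id := by
  refine lintegral_congr_ae ?_
  filter_upwards [(ae_ball_iff A.countable_toSet).2 fun t _ => enorm_kernel_rpow h hα hc f t]
    with s hs
  rw [enorm_restrict_rpow hα A hA fun t => kernel α m φ c f t s]
  exact Finset.sup_congr rfl hs

theorem kernel_congr_ae (h : IsNonsingularAction m φ) {f f' : S → ℝ} (hff' : f =ᵐ[m] f') (t : G) :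
    kernel α m φ c f t =ᵐ[m] kernel α m φ c f' t := by
  filter_upwards [(h.quasiMeasurePreserving t).ae_eq_comp hff'] with s hs
  simp only [Function.comp_apply] at hs
  rw [kernel, kernel, hs]

end Kernel

section Ratio

variable {d : ℕ} {S : Type*} [MeasurableSpace S] {m : Measure S}
  {φ : FreeGroup (Fin d) → S → S} {α : ℝ} {c : FreeGroup (Fin d) → S → ℝ}

theorem bRatio_congr_ae [SigmaFinite m] (h : IsNonsingularAction m φ) {f f' : S → ℝ}
    (hff' : f =ᵐ[m] f') : bRatio α m φ c f = bRatio α m φ c f' := by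
  funext n
  have : ∀ᵐ s ∂m, ∀ t ∈ ball d n, kernel α m φ c f t s = kernel α m φ c f' t s :=
    (ae_ball_iff (ball d n).countable_toSet).2 fun t _ => kernel_congr_ae h hff' t
  rw [bRatio, bRatio, b, b]
  congr 2
  refine integral_congr_ae ?_
  filter_upwards [this] with s hs
  exact Finset.sup'_congr _ rfl fun t ht => by rw [hs t ht]

theorem b_eq [SigmaFinite m] (h : IsNonsingularAction m φ) (hα : 0 < α)
    (hcm : ∀ t, Measurable (c t)) (hc : ∀ t s, c t s = 1 ∨ c t s = -1) {f : S → ℝ}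
    (hf : Measurable f) (n : ℕ) :
    b α m φ c f n = (maxIntegral m φ (fun s => ‖f s‖ₑ ^ α) (ball d n) id).toReal ^ (1 / α) := by
  rw [b, ← lintegral_enorm_restrict_kernel h hα hc f _ (ball_nonempty d n)]
  congr 1
  simp_rw [sup'_abs_rpow hα]
  rw [integral_eq_lintegral_of_nonneg_ae (.of_forall fun s => by positivity)]
  · congr 1
    refine lintegral_congr fun s => ?_
    rw [← ENNReal.ofReal_rpow_of_nonneg (norm_nonneg _) hα.le, ofReal_norm]
  · exact ((measurable_pi_lambda _ fun t : ball d n =>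
      measurable_kernel h hcm hf (t : FreeGroup (Fin d))).norm.pow_const _).aestronglyMeasurable

theorem bRatio_eq [SigmaFinite m] (h : IsNonsingularAction m φ) (hα : 0 < α)
    (hcm : ∀ t, Measurable (c t)) (hc : ∀ t s, c t s = 1 ∨ c t s = -1) {f : S → ℝ}
    (hf : Measurable f) (n : ℕ) :
    bRatio α m φ c f n = avgMax m φ (fun s => ‖f s‖ₑ ^ α) n ^ (1 / α) := by
  rw [bRatio, b_eq h hα hcm hc hf, avgMax,
    Real.div_rpow ENNReal.toReal_nonneg (card_ball_pos d n).le]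

theorem tendsto_bRatio_iff [SigmaFinite m] (h : IsNonsingularAction m φ) (hα : 0 < α)
    (hcm : ∀ t, Measurable (c t)) (hc : ∀ t s, c t s = 1 ∨ c t s = -1) {f : S → ℝ}
    (hf : Measurable f) : Tendsto (bRatio α m φ c f) atTop (𝓝 0) ↔
      Tendsto (avgMax m φ fun s => ‖f s‖ₑ ^ α) atTop (𝓝 0) := by
  have h1 : bRatio α m φ c f = fun n => avgMax m φ (fun s => ‖f s‖ₑ ^ α) n ^ (1 / α) :=
    funext (bRatio_eq h hα hcm hc hf)
  rw [h1]
  constructor <;> intro h2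
  · have := h2.rpow_const (p := α) (Or.inr hα.le)
    rw [Real.zero_rpow hα.ne'] at this
    refine this.congr fun n => ?_
    rw [← Real.rpow_mul (avgMax_nonneg _ _), one_div_mul_cancel hα.ne', Real.rpow_one]
  · have := h2.rpow_const (p := 1 / α) (Or.inr (by positivity))
    rwa [Real.zero_rpow (by positivity)] at this

theorem lintegral_enorm_rpow_ne_top (hα : 0 < α) {f : S → ℝ}
    (hf : MemLp f (ENNReal.ofReal α) m) : ∫⁻ s, ‖f s‖ₑ ^ α ∂m ≠ ⊤ := by
  have := (eLpNorm_lt_top_iff_lintegral_rpow_enorm_lt_top (by simpa using hα)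
    ENNReal.ofReal_ne_top).1 hf.eLpNorm_lt_top
  rw [ENNReal.toReal_ofReal hα.le] at this
  exact this.ne

/-- If the averages of the maximal function of `f` tend to zero, then the support of `f` is a
degenerate set; so they stay away from zero as soon as `f` charges the nondegenerate part. -/
theorem exists_le_avgMax [SigmaFinite m] (hd : 2 ≤ d) (h : IsNonsingularAction m φ) (hα : 0 < α)
    (hcm : ∀ t, Measurable (c t)) (hc : ∀ t s, c t s = 1 ∨ c t s = -1) {A : Set S}
    (hA : IsNondegeneratePart α m φ c A) {f : S → ℝ} (hf : Measurable f)
    (hfm : MemLp f (ENNReal.ofReal α) m) (hfA : 0 < m (Function.support f ∩ A)) :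
    ∃ ε > 0, ∀ᶠ n in atTop, ε ≤ avgMax m φ (fun s => ‖f s‖ₑ ^ α) n := by
  have hfi := lintegral_enorm_rpow_ne_top hα hfm
  refine (avgMax_dichotomy hd h (hf.enorm.pow_const α) hfi).resolve_left fun hlim => hfA.ne' ?_
  have hdeg : IsDegenerateSet α m φ c (Function.support f) := by
    refine ⟨measurableSet_support hf, fun g hg hsupp => ?_⟩
    obtain ⟨g', hg'm, hgg'⟩ := hg.1.aemeasurable
    rw [bRatio_congr_ae h hgg', tendsto_bRatio_iff h hα hcm hc hg'm]
    refine tendsto_avgMax_of_support h (hf.enorm.pow_const α) hfi (hg'm.enorm.pow_const α)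
      (lintegral_enorm_rpow_ne_top hα ((memLp_congr_ae hgg').1 hg)) ?_ hlim
    filter_upwards [hsupp, hgg'] with s hs hs' h0
    have : f s = 0 := by
      simpa [ENNReal.rpow_eq_zero_iff, hα, hα.not_gt] using h0
    have : g' s = 0 := by rw [← hs', hs (by simpa using this)]
    simp [this, hα]
  have := hA.contains _ hdeg
  rw [ae_le_set] at this
  simpa [Set.sdiff_eq] using this

theorem liminf_bRatio_pos [SigmaFinite m] (h : IsNonsingularAction m φ) (hα : 0 < α)
    (hcm : ∀ t, Measurable (c t)) (hc : ∀ t s, c t s = 1 ∨ c t s = -1) {f : S → ℝ}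
    (hf : Measurable f) (hfm : MemLp f (ENNReal.ofReal α) m)
    (hε : ∃ ε > 0, ∀ᶠ n in atTop, ε ≤ avgMax m φ (fun s => ‖f s‖ₑ ^ α) n) :
    0 < liminf (bRatio α m φ c f) atTop := by
  obtain ⟨ε, hε, hev⟩ := hε
  have hα' : 0 < 1 / α := by positivity
  refine (Real.rpow_pos_of_pos hε (1 / α)).trans_le (le_liminf_of_le ?_ ?_)
  · refine IsBoundedUnder.isCoboundedUnder_ge
      (isBoundedUnder_of ⟨(∫⁻ s, ‖f s‖ₑ ^ α ∂m).toReal ^ (1 / α), fun n => ?_⟩)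
    rw [bRatio_eq h hα hcm hc hf]
    exact Real.rpow_le_rpow (avgMax_nonneg _ _)
      (avgMax_le h (hf.enorm.pow_const α) (lintegral_enorm_rpow_ne_top hα hfm) n) hα'.le
  · filter_upwards [hev] with n hn
    rw [bRatio_eq h hα hcm hc hf]
    exact Real.rpow_le_rpow hε.le hn hα'.le

end Ratio

/-! ### Fourth moments of sums of independent centred variables -/

section FourthMoment

open ProbabilityTheory

variable {Ω κ : Type*} [MeasurableSpace Ω] {P : Measure Ω} [IsProbabilityMeasure P]
  {Y : κ → Ω → ℝ} {ε v : ℝ}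

theorem integrable_of_abs_le {g : Ω → ℝ} (hg : Measurable g) {K : ℝ} (hK : ∀ ω, |g ω| ≤ K) :
    Integrable g P :=
  Integrable.of_bound hg.aestronglyMeasurable K (.of_forall hK)

/-- Moments of a sum of bounded, centred, independent variables. Third moments need not vanish: in
the expansion of the fourth power they are multiplied by a mean, which is zero. -/
theorem moments_sum_le (hind : iIndepFun Y P) (hm : ∀ i, Measurable (Y i))
    (hb : ∀ i ω, |Y i ω| ≤ ε) (h0 : ∀ i, ∫ ω, Y i ω ∂P = 0) (h2 : ∀ i, ∫ ω, Y i ω ^ 2 ∂P ≤ v)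
    (hv : 0 ≤ v) (s : Finset κ) :
    ∫ ω, ∑ i ∈ s, Y i ω ∂P = 0 ∧ ∫ ω, (∑ i ∈ s, Y i ω) ^ 2 ∂P ≤ s.card * v ∧
      ∫ ω, (∑ i ∈ s, Y i ω) ^ 4 ∂P ≤ s.card * (ε ^ 2 * v) + 3 * s.card ^ 2 * v ^ 2 := by
  classical
  induction s using Finset.induction_on with
  | empty => simp
  | insert i s hi ih =>
    obtain ⟨ih1, ih2, ih4⟩ := ih
    set T : Ω → ℝ := fun ω => ∑ j ∈ s, Y j ω with hT
    have hTm : Measurable T := Finset.measurable_fun_sum s fun j _ => hm j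
    have hTb (ω) : |T ω| ≤ s.card * ε := by
      refine (Finset.abs_sum_le_sum_abs _ _).trans ((Finset.sum_le_sum fun j _ => hb j ω).trans ?_)
      simp
    have hTint (a : ℕ) : Integrable (fun ω => T ω ^ a) P :=
      integrable_of_abs_le (hTm.pow_const a) (K := (s.card * ε) ^ a) fun ω => by
        rw [abs_pow]; exact pow_le_pow_left₀ (abs_nonneg _) (hTb ω) a
    have hYint (a : ℕ) : Integrable (fun ω => Y i ω ^ a) P :=
      integrable_of_abs_le ((hm i).pow_const a) (K := ε ^ a) fun ω => by
        rw [abs_pow]; exact pow_le_pow_left₀ (abs_nonneg _) (hb i ω) a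
    have hTY : IndepFun T (Y i) P := by
      have := hind.indepFun_finsetSum_of_notMem hm hi
      rwa [show ∑ j ∈ s, Y j = T from by ext ω; simp [hT]] at this
    have hpow (a e : ℕ) : IndepFun (fun ω => T ω ^ a) (fun ω => Y i ω ^ e) P :=
      hTY.comp (φ := fun x : ℝ => x ^ a) (ψ := fun x : ℝ => x ^ e)
        (measurable_id.pow_const a) (measurable_id.pow_const e)
    have hmul (a e : ℕ) : ∫ ω, T ω ^ a * Y i ω ^ e ∂P = (∫ ω, T ω ^ a ∂P) * ∫ ω, Y i ω ^ e ∂P :=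
      (hpow a e).integral_fun_mul_eq_mul_integral (hTint a).1 (hYint e).1
    have hint (a e : ℕ) : Integrable (fun ω => T ω ^ a * Y i ω ^ e) P :=
      (hpow a e).integrable_mul (hTint a) (hYint e)
    have hy1 : ∫ ω, Y i ω ^ 1 ∂P = 0 := by simpa using h0 i
    have ht1 : ∫ ω, T ω ^ 1 ∂P = 0 := by simpa using ih1
    have hy4 : ∫ ω, Y i ω ^ 4 ∂P ≤ ε ^ 2 * v := by
      calc ∫ ω, Y i ω ^ 4 ∂P ≤ ∫ ω, ε ^ 2 * Y i ω ^ 2 ∂P := by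
            refine integral_mono (hYint 4) ((hYint 2).const_mul _) fun ω => ?_
            have : Y i ω ^ 2 ≤ ε ^ 2 := sq_le_sq' (abs_le.1 (hb i ω)).1 (abs_le.1 (hb i ω)).2
            dsimp only
            nlinarith [sq_nonneg (Y i ω)]
        _ ≤ ε ^ 2 * v := by
            rw [integral_const_mul]
            exact mul_le_mul_of_nonneg_left (h2 i) (sq_nonneg _)
    have hsum (ω) : ∑ j ∈ insert i s, Y j ω = T ω + Y i ω := by
      rw [Finset.sum_insert hi, add_comm]
    simp only [hsum, Finset.card_insert_of_notMem hi]
    push_cast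
    refine ⟨?_, ?_, ?_⟩
    · rw [integral_add (by simpa using hTint 1) (by simpa using hYint 1), ih1, h0, add_zero]
    · have : ∫ ω, (T ω + Y i ω) ^ 2 ∂P
          = ∫ ω, T ω ^ 2 ∂P + 2 * ∫ ω, T ω ^ 1 * Y i ω ^ 1 ∂P + ∫ ω, Y i ω ^ 2 ∂P := by
        have i1 : Integrable (fun ω => T ω ^ 2 + 2 * (T ω ^ 1 * Y i ω ^ 1)) P :=
          (hTint 2).add ((hint 1 1).const_mul 2)
        rw [← integral_const_mul, ← integral_add (hTint 2) ((hint 1 1).const_mul 2),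
          ← integral_add i1 (hYint 2)]
        exact integral_congr_ae (.of_forall fun ω => by ring)
      rw [this, hmul, ht1]
      linarith [h2 i]
    · have : ∫ ω, (T ω + Y i ω) ^ 4 ∂P
          = ∫ ω, T ω ^ 4 ∂P + 4 * ∫ ω, T ω ^ 3 * Y i ω ^ 1 ∂P + 6 * ∫ ω, T ω ^ 2 * Y i ω ^ 2 ∂P
            + 4 * ∫ ω, T ω ^ 1 * Y i ω ^ 3 ∂P + ∫ ω, Y i ω ^ 4 ∂P := by
        have i1 : Integrable (fun ω => T ω ^ 4 + 4 * (T ω ^ 3 * Y i ω ^ 1)) P :=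
          (hTint 4).add ((hint 3 1).const_mul 4)
        have i2 : Integrable
            (fun ω => T ω ^ 4 + 4 * (T ω ^ 3 * Y i ω ^ 1) + 6 * (T ω ^ 2 * Y i ω ^ 2)) P :=
          i1.add ((hint 2 2).const_mul 6)
        have i3 : Integrable (fun ω => T ω ^ 4 + 4 * (T ω ^ 3 * Y i ω ^ 1)
            + 6 * (T ω ^ 2 * Y i ω ^ 2) + 4 * (T ω ^ 1 * Y i ω ^ 3)) P :=
          i2.add ((hint 1 3).const_mul 4)
        rw [← integral_const_mul, ← integral_const_mul, ← integral_const_mul,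
          ← integral_add (hTint 4) ((hint 3 1).const_mul 4),
          ← integral_add i1 ((hint 2 2).const_mul 6), ← integral_add i2 ((hint 1 3).const_mul 4),
          ← integral_add i3 (hYint 4)]
        exact integral_congr_ae (.of_forall fun ω => by ring)
      rw [this, hmul, hmul, hmul, hy1, ht1]
      have hT2 : 0 ≤ ∫ ω, T ω ^ 2 ∂P := integral_nonneg fun ω => sq_nonneg _
      have hprod : (∫ ω, T ω ^ 2 ∂P) * ∫ ω, Y i ω ^ 2 ∂P ≤ s.card * v * v :=
        mul_le_mul ih2 (h2 i) (integral_nonneg fun ω => sq_nonneg _) (by positivity)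
      nlinarith [sq_nonneg v]

end FourthMoment

/-! ### The Fréchet law -/

theorem frechet_Iic {α : ℝ} (hα : 0 < α) (r : ℝ) :
    frechet α hα (Set.Iic r) = ENNReal.ofReal (if 0 < r then Real.exp (-r ^ (-α)) else 0) := by
  rw [frechet, StieltjesFunction.measure_Iic _ (l := 0), sub_zero]
  · rfl
  · refine tendsto_const_nhds.congr' ?_
    filter_upwards [eventually_le_atBot 0] with y hy
    exact (if_neg (not_lt.2 hy)).symm

section MaxStable

variable {ι : Type*} [Fintype ι]

/-- Max-stability: if the norm of a random vector has the Fréchet law, then so has the normalised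
maximum of the norms of `k` independent copies. (The norm of `x : Fin k → ι → ℝ` is the maximum of
the norms of the vectors `x i`.) -/
theorem map_norm_pi {α : ℝ} (hα : 0 < α) {ν : Measure (ι → ℝ)} [IsProbabilityMeasure ν]
    (hν : ν.map norm = frechet α hα) {k : ℕ} (hk : 0 < k) :
    (Measure.pi fun _ : Fin k => ν).map (fun x => (k : ℝ) ^ (-(1 / α)) * ‖x‖) = frechet α hα := by
  have : Nonempty (Fin k) := ⟨⟨0, hk⟩⟩
  have hk' : (0 : ℝ) < k := by exact_mod_cast hk
  have ha : 0 < (k : ℝ) ^ (-(1 / α)) := Real.rpow_pos_of_pos hk' _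
  have hm : Measurable fun x : Fin k → ι → ℝ => (k : ℝ) ^ (-(1 / α)) * ‖x‖ := by fun_prop
  have := Measure.isProbabilityMeasure_map (μ := Measure.pi fun _ : Fin k => ν) hm.aemeasurable
  refine Measure.ext_of_Iic _ _ fun r => ?_
  have hset : (fun x : Fin k → ι → ℝ => (k : ℝ) ^ (-(1 / α)) * ‖x‖) ⁻¹' Set.Iic r
      = Set.univ.pi fun _ => norm ⁻¹' Set.Iic (r / (k : ℝ) ^ (-(1 / α))) := by
    ext x
    simp only [Set.mem_preimage, Set.mem_Iic, Set.mem_univ_pi]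
    rw [← pi_norm_le_iff_of_nonempty, le_div_iff₀ ha, mul_comm]
  rw [Measure.map_apply hm measurableSet_Iic, hset, Measure.pi_pi]
  simp only [← Measure.map_apply measurable_norm measurableSet_Iic, hν, Finset.prod_const,
    Finset.card_univ, Fintype.card_fin, frechet_Iic]
  by_cases hr : 0 < r
  · rw [if_pos hr, if_pos (div_pos hr ha), ← ENNReal.ofReal_pow (Real.exp_pos _).le,
      ← Real.exp_nat_mul, Real.div_rpow hr.le ha.le, ← Real.rpow_mul hk'.le]
    congr 2
    have : -(1 / α) * -α = 1 := by field_simp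
    rw [this, Real.rpow_one]
    field_simp
  · rw [if_neg hr, if_neg fun h => hr ((div_pos_iff_of_pos_right ha).1 h)]
    simp [hk.ne']

end MaxStable

/-! ### Sums and maxima of heavy-tailed vectors -/

/-- Truncation of a real number at level `ε`: large values are replaced by zero. -/
noncomputable def trunc (ε u : ℝ) : ℝ := if |u| ≤ ε then u else 0

theorem measurable_trunc (ε : ℝ) : Measurable (trunc ε) :=
  Measurable.ite (measurableSet_le measurable_norm measurable_const) measurable_id measurable_const

theorem abs_trunc_le {ε : ℝ} (hε : 0 ≤ ε) (u : ℝ) : |trunc ε u| ≤ ε := by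
  unfold trunc
  split_ifs with h
  · exact h
  · simpa using hε

theorem trunc_neg (ε u : ℝ) : trunc ε (-u) = -trunc ε u := by
  unfold trunc
  rw [abs_neg]
  split_ifs <;> simp

section Comparison

variable {ι : Type*} [Fintype ι]

/-- If in every coordinate at most one of the vectors `x i` exceeds `ε`, and the smaller
contributions add up to at most `δ`, then the norm of the sum is close to the largest norm. -/
theorem abs_norm_sum_sub_norm_le {k : ℕ} (x : Fin k → ι → ℝ) {ε δ : ℝ}
    (hε : 0 ≤ ε) (hδ : 0 ≤ δ) (h1 : ∀ t i j, ε < |x i t| → ε < |x j t| → i = j)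
    (h2 : ∀ t, |∑ i, trunc ε (x i t)| ≤ δ) : |‖∑ i, x i‖ - ‖x‖| ≤ δ + ε := by
  -- the contribution of a single large coordinate dominates the sum
  have hbig (t i) (hi : ε < |x i t|) : |∑ j, x j t - x i t| ≤ δ := by
    have : ∑ j, x j t - x i t = ∑ j, trunc ε (x j t) := by
      rw [← Finset.sum_erase_add _ _ (Finset.mem_univ i),
        ← Finset.sum_erase_add Finset.univ (fun j => trunc ε (x j t)) (Finset.mem_univ i),
        trunc, if_neg (not_le.2 hi), add_zero, add_sub_cancel_right]
      refine Finset.sum_congr rfl fun j hj => ?_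
      rw [trunc, if_pos]
      by_contra hj'
      exact (Finset.mem_erase.1 hj).1 (h1 t j i (not_le.1 hj') hi)
    rw [this]
    exact h2 t
  have hx (i t) : |x i t| ≤ ‖x‖ := (norm_le_pi_norm (x i) t).trans (norm_le_pi_norm x i)
  have hsum (t) : |∑ j, x j t| ≤ ‖∑ j, x j‖ := by
    simpa using norm_le_pi_norm (∑ j, x j) t
  rw [abs_le]
  constructor
  · have : ‖x‖ ≤ ‖∑ i, x i‖ + (δ + ε) := by
      refine (pi_norm_le_iff_of_nonneg (by positivity)).2 fun i =>
        (pi_norm_le_iff_of_nonneg (by positivity)).2 fun t => ?_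
      rw [Real.norm_eq_abs]
      by_cases hi : ε < |x i t|
      · have h3 := abs_sub_abs_le_abs_sub (x i t) (∑ j, x j t)
        rw [abs_sub_comm] at h3
        linarith [hbig t i hi, hsum t]
      · linarith [norm_nonneg (∑ i, x i)]
    linarith
  · have : ‖∑ i, x i‖ ≤ ‖x‖ + (δ + ε) := by
      refine (pi_norm_le_iff_of_nonneg (by positivity)).2 fun t => ?_
      rw [Finset.sum_apply, Real.norm_eq_abs]
      by_cases hi : ∃ i, ε < |x i t|
      · obtain ⟨i, hi⟩ := hi
        linarith [hbig t i hi, hx i t, abs_sub_abs_le_abs_sub (∑ j, x j t) (x i t)]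
      · push Not at hi
        have : ∑ j, x j t = ∑ j, trunc ε (x j t) :=
          Finset.sum_congr rfl fun j _ => by rw [trunc, if_pos (hi j)]
        rw [this]
        linarith [h2 t, norm_nonneg x]
    linarith

/-- A symmetric law `ν` on `ℝ^ι` for which the maximum norm has the `α`-Fréchet law, while each
coordinate has a tail of order at most `ρ r^{-α}`; the truncated second moments have the
corresponding order `ρ r^{2-α}`. -/
structure IsHeavyTailed (α : ℝ) (hα : 0 < α) (ν : Measure (ι → ℝ)) (ρ : ℝ) : Prop where
  map_neg : ν.map Neg.neg = ν
  map_norm : ν.map norm = frechet α hα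
  tail : ∀ t r, 0 < r → ν.real {x | r < |x t|} ≤ ρ * r ^ (-α)
  sq_trunc : ∀ t r, 0 < r → ∫ x, trunc r (x t) ^ 2 ∂ν ≤ α / (2 - α) * (ρ * r ^ (2 - α))

variable {α ρ : ℝ} {hα : 0 < α} {ν : Measure (ι → ℝ)}

theorem trunc_mul {a ε : ℝ} (ha : 0 < a) (u : ℝ) : trunc ε (a * u) = a * trunc (ε / a) u := by
  simp only [trunc, abs_mul, abs_of_pos ha, le_div_iff₀ ha, mul_comm |u| a, mul_ite, mul_zero]

open ProbabilityTheory in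
/-- The probability that two of `k` normalised heavy-tailed vectors are large in the coordinate `t`:
there are fewer than `k²` pairs, each contributing at most `(ρ ε^{-α} / k)²`. -/
theorem measureReal_pi_two_large_le [IsProbabilityMeasure ν] (hν : IsHeavyTailed α hα ν ρ)
    {k : ℕ} (hk : 0 < k) {ε : ℝ} (hε : 0 < ε) (t : ι) :
    (Measure.pi fun _ : Fin k => ν).real {x | ∃ i j, i ≠ j ∧
      ε < |(k : ℝ) ^ (-(1 / α)) * x i t| ∧ ε < |(k : ℝ) ^ (-(1 / α)) * x j t|}
      ≤ (ρ * ε ^ (-α)) ^ 2 := by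
  have hk' : (0 : ℝ) < k := by exact_mod_cast hk
  set a := (k : ℝ) ^ (-(1 / α)) with ha_def
  have ha : 0 < a := Real.rpow_pos_of_pos hk' _
  set μ := Measure.pi fun _ : Fin k => ν
  set U : Set (ι → ℝ) := {x | ε / a < |x t|}
  have hU : MeasurableSet U := measurableSet_lt measurable_const (measurable_pi_apply t).norm
  have haα : (ε / a) ^ (-α) = ε ^ (-α) / k := by
    rw [Real.div_rpow hε.le ha.le, ha_def, ← Real.rpow_mul hk'.le]
    have : -(1 / α) * -α = 1 := by field_simp
    rw [this, Real.rpow_one]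
  have hq : ν.real U ≤ ρ * ε ^ (-α) / k := by
    rw [mul_div_assoc, ← haα]
    exact hν.tail t _ (div_pos hε ha)
  have hsub : {x : Fin k → ι → ℝ | ∃ i j, i ≠ j ∧ ε < |a * x i t| ∧ ε < |a * x j t|}
      ⊆ ⋃ p ∈ (Finset.univ : Finset (Fin k)).offDiag, {x | x p.1 ∈ U ∧ x p.2 ∈ U} := by
    rintro x ⟨i, j, hij, hi, hj⟩
    simp only [Set.mem_iUnion, Finset.mem_offDiag, Finset.mem_univ, true_and]
    rw [abs_mul, abs_of_pos ha, ← div_lt_iff₀' ha] at hi hj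
    exact ⟨(i, j), hij, hi, hj⟩
  have hind : iIndepFun (fun (i : Fin k) (x : Fin k → ι → ℝ) => x i) μ :=
    iIndepFun_pi (X := fun _ => id) fun _ => aemeasurable_id
  have hpair (p) (hp : p ∈ (Finset.univ : Finset (Fin k)).offDiag) :
      μ.real {x | x p.1 ∈ U ∧ x p.2 ∈ U} ≤ (ρ * ε ^ (-α) / k) ^ 2 := by
    have h1 := (hind.indepFun (Finset.mem_offDiag.1 hp).2.2).measure_inter_preimage_eq_mul U U hU hU
    have h2 (i : Fin k) : μ ((fun x => x i) ⁻¹' U) = ν U :=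
      (measurePreserving_eval (fun _ : Fin k => ν) i).measure_preimage hU.nullMeasurableSet
    have h3 : μ.real {x | x p.1 ∈ U ∧ x p.2 ∈ U} = ν.real U ^ 2 := by
      rw [h2, h2] at h1
      rw [sq, Measure.real, Measure.real, ← ENNReal.toReal_mul, ← h1]
      rfl
    rw [h3]
    exact pow_le_pow_left₀ measureReal_nonneg hq 2
  calc _ ≤ μ.real (⋃ p ∈ (Finset.univ : Finset (Fin k)).offDiag, {x | x p.1 ∈ U ∧ x p.2 ∈ U}) :=
        measureReal_mono hsub (measure_ne_top _ _)
    _ ≤ ∑ p ∈ (Finset.univ : Finset (Fin k)).offDiag, μ.real {x | x p.1 ∈ U ∧ x p.2 ∈ U} :=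
        measureReal_biUnion_finset_le _ _
    _ ≤ ∑ p ∈ (Finset.univ : Finset (Fin k)).offDiag, (ρ * ε ^ (-α) / k) ^ 2 :=
        Finset.sum_le_sum hpair
    _ ≤ ∑ p : Fin k × Fin k, (ρ * ε ^ (-α) / k) ^ 2 :=
        Finset.sum_le_sum_of_subset_of_nonneg (Finset.subset_univ _) fun _ _ _ => sq_nonneg _
    _ = (ρ * ε ^ (-α)) ^ 2 := by
        rw [Finset.sum_const, Finset.card_univ, Fintype.card_prod, Fintype.card_fin, nsmul_eq_mul]
        push_cast
        field_simp

open ProbabilityTheory in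
/-- The probability that the small contributions to the coordinate `t` add up to more than `δ`, by
Markov's inequality for the fourth power. -/
theorem measureReal_pi_sum_trunc_le [IsProbabilityMeasure ν] (hν : IsHeavyTailed α hα ν ρ)
    (hα2 : α < 2) (hρ : 0 ≤ ρ) {k : ℕ} (hk : 0 < k) {ε δ : ℝ} (hε : 0 < ε) (hδ : 0 < δ) (t : ι) :
    (Measure.pi fun _ : Fin k => ν).real
      {x | δ < |∑ i, trunc ε ((k : ℝ) ^ (-(1 / α)) * x i t)|}
      ≤ (ε ^ 2 * (α / (2 - α) * (ρ * ε ^ (2 - α)))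
        + 3 * (α / (2 - α) * (ρ * ε ^ (2 - α))) ^ 2) / δ ^ 4 := by
  have hk' : (0 : ℝ) < k := by exact_mod_cast hk
  set a := (k : ℝ) ^ (-(1 / α)) with ha_def
  have ha : 0 < a := Real.rpow_pos_of_pos hk' _
  set μ := Measure.pi fun _ : Fin k => ν
  have h2α : 0 < 2 - α := by linarith
  set w := α / (2 - α) * (ρ * ε ^ (2 - α)) with hw
  have hw0 : 0 ≤ w := by positivity
  have hm : Measurable fun x : ι → ℝ => trunc ε (a * x t) :=
    (measurable_trunc ε).comp (by fun_prop)
  set Y : Fin k → (Fin k → ι → ℝ) → ℝ := fun i x => trunc ε (a * x i t) with hY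
  have hYm (i) : Measurable (Y i) := hm.comp (measurable_pi_apply i)
  have hYb (i x) : |Y i x| ≤ ε := abs_trunc_le hε.le _
  have hind : iIndepFun Y μ :=
    iIndepFun_pi (X := fun _ (x : ι → ℝ) => trunc ε (a * x t)) fun _ => hm.aemeasurable
  have hint (i) (g : (ι → ℝ) → ℝ) (hg : Measurable g) : ∫ x, g (x i) ∂μ = ∫ x, g x ∂ν := by
    have := measurePreserving_eval (fun _ : Fin k => ν) i
    conv_rhs => rw [← this.map_eq]
    rw [integral_map this.measurable.aemeasurable hg.aestronglyMeasurable]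
  have h0 (i) : ∫ x, Y i x ∂μ = 0 := by
    rw [hint i _ hm]
    have h1 : ∫ x : ι → ℝ, trunc ε (a * x t) ∂ν = ∫ x : ι → ℝ, -trunc ε (a * x t) ∂ν := by
      conv_lhs => rw [← hν.map_neg]
      rw [integral_map measurable_neg.aemeasurable hm.aestronglyMeasurable]
      simp [trunc_neg]
    rw [integral_neg] at h1
    linarith
  have h2 (i) : ∫ x, Y i x ^ 2 ∂μ ≤ w / k := by
    rw [hint i (fun x => trunc ε (a * x t) ^ 2) (hm.pow_const 2)]
    simp_rw [trunc_mul ha, mul_pow]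
    rw [integral_const_mul]
    refine (mul_le_mul_of_nonneg_left (hν.sq_trunc t _ (div_pos hε ha)) (sq_nonneg a)).trans
      (le_of_eq ?_)
    have hakα : a ^ α = 1 / k := by
      rw [ha_def, ← Real.rpow_mul hk'.le]
      have : -(1 / α) * α = -1 := by field_simp
      rw [this, Real.rpow_neg_one, one_div]
    have : (ε / a) ^ (2 - α) = ε ^ (2 - α) / (a ^ 2 * k) := by
      rw [Real.div_rpow hε.le ha.le]
      congr 1
      rw [Real.rpow_sub ha, hakα]
      norm_num
    rw [this, hw]
    field_simp
  obtain ⟨-, -, h4⟩ := moments_sum_le hind hYm hYb h0 h2 (by positivity) Finset.univ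
  rw [Finset.card_univ, Fintype.card_fin] at h4
  have hbound : (k : ℝ) * (ε ^ 2 * (w / k)) + 3 * (k : ℝ) ^ 2 * (w / k) ^ 2
      = ε ^ 2 * w + 3 * w ^ 2 := by field_simp
  rw [hbound] at h4
  have hmeas : Measurable fun x => ∑ i, Y i x := Finset.measurable_fun_sum _ fun i _ => hYm i
  have hint4 : Integrable (fun x => (∑ i, Y i x) ^ 4) μ :=
    integrable_of_abs_le (hmeas.pow_const 4) (K := (k * ε) ^ 4) fun x => by
      rw [abs_pow]
      refine pow_le_pow_left₀ (abs_nonneg _) ((Finset.abs_sum_le_sum_abs _ _).trans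
        ((Finset.sum_le_sum fun j _ => hYb j x).trans (by simp))) 4
  have hmarkov := mul_meas_ge_le_integral_of_nonneg (μ := μ)
    (.of_forall fun x => by positivity) hint4 (δ ^ 4)
  rw [le_div_iff₀ (by positivity), mul_comm]
  refine le_trans (mul_le_mul_of_nonneg_left (measureReal_mono fun x hx => ?_) (by positivity))
    (hmarkov.trans h4)
  have h5 : δ ^ 4 ≤ |∑ i, Y i x| ^ 4 :=
    pow_le_pow_left₀ hδ.le (le_of_lt hx) 4
  rwa [← abs_pow, abs_of_nonneg (by positivity)] at h5

/-- A bound for the probability that the largest coordinate of a normalised sum of heavy-tailed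
vectors in dimension `N` is not within `δ + ε` of the largest coordinate of a summand. -/
noncomputable def errorBound (α N ρ ε δ : ℝ) : ℝ :=
  N * ((ρ * ε ^ (-α)) ^ 2 + (ε ^ 2 * (α / (2 - α) * (ρ * ε ^ (2 - α)))
    + 3 * (α / (2 - α) * (ρ * ε ^ (2 - α))) ^ 2) / δ ^ 4)

/-- The normalised sum of `k` independent heavy-tailed vectors behaves like the largest summand:
the law of its maximum norm is close to the Fréchet law, uniformly in `k`. -/
theorem abs_integral_norm_sum_sub_le [IsProbabilityMeasure ν] (hν : IsHeavyTailed α hα ν ρ)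
    (hα2 : α < 2) (hρ : 0 ≤ ρ) {k : ℕ} (hk : 0 < k) {ε δ : ℝ} (hε : 0 < ε) (hδ : 0 < δ)
    {h : ℝ → ℝ} {L : NNReal} {H : ℝ} (hL : LipschitzWith L h) (hH : ∀ u v, dist (h u) (h v) ≤ H) :
    |∫ x, h ‖(k : ℝ) ^ (-(1 / α)) • ∑ i, x i‖ ∂(Measure.pi fun _ : Fin k => ν)
      - ∫ z, h z ∂(frechet α hα)|
      ≤ L * (δ + ε) + H * errorBound α (Fintype.card ι) ρ ε δ := by
  have hk' : (0 : ℝ) < k := by exact_mod_cast hk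
  set a := (k : ℝ) ^ (-(1 / α)) with ha_def
  have ha : 0 < a := Real.rpow_pos_of_pos hk' _
  set μ := Measure.pi fun _ : Fin k => ν
  have hH0 : 0 ≤ H := dist_nonneg.trans (hH 0 0)
  have hhb (u) : |h u| ≤ |h 0| + H := by
    have := hH u 0
    rw [Real.dist_eq] at this
    linarith [abs_sub_abs_le_abs_sub (h u) (h 0)]
  have hhm : Measurable h := hL.continuous.measurable
  have hm1 : Measurable fun x : Fin k → ι → ℝ => h ‖a • ∑ i, x i‖ := hhm.comp (by fun_prop)
  have hm2 : Measurable fun x : Fin k → ι → ℝ => h (a * ‖x‖) := hhm.comp (by fun_prop)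
  have hi1 : Integrable (fun x : Fin k → ι → ℝ => h ‖a • ∑ i, x i‖) μ :=
    integrable_of_abs_le hm1 fun x => hhb _
  have hi2 : Integrable (fun x : Fin k → ι → ℝ => h (a * ‖x‖)) μ :=
    integrable_of_abs_le hm2 fun x => hhb _
  have hfr : ∫ z, h z ∂(frechet α hα) = ∫ x : Fin k → ι → ℝ, h (a * ‖x‖) ∂μ := by
    rw [← map_norm_pi hα hν.map_norm hk,
      integral_map (by fun_prop) hhm.aestronglyMeasurable]
  set bad1 : ι → Set (Fin k → ι → ℝ) := fun t =>
    {x | ∃ i j, i ≠ j ∧ ε < |a * x i t| ∧ ε < |a * x j t|}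
  set bad2 : ι → Set (Fin k → ι → ℝ) := fun t => {x | δ < |∑ i, trunc ε (a * x i t)|}
  have hb1m (t) : MeasurableSet (bad1 t) := by
    have : bad1 t = ⋃ i, ⋃ j, ⋃ (_ : i ≠ j),
        {x : Fin k → ι → ℝ | ε < |a * x i t|} ∩ {x | ε < |a * x j t|} := by
      ext x; simp only [bad1, Set.mem_ofPred_eq, Set.mem_iUnion, Set.mem_inter_iff, exists_prop]
    rw [this]
    have hi (i : Fin k) : MeasurableSet {x : Fin k → ι → ℝ | ε < |a * x i t|} :=
      measurableSet_lt measurable_const (by fun_prop)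
    exact .iUnion fun i => .iUnion fun j => .iUnion fun _ => (hi i).inter (hi j)
  have hb2m (t) : MeasurableSet (bad2 t) :=
    measurableSet_lt measurable_const (Finset.measurable_fun_sum _ fun i _ =>
      (measurable_trunc ε).comp (by fun_prop)).norm
  set bad : Set (Fin k → ι → ℝ) := ⋃ t ∈ (Finset.univ : Finset ι), (bad1 t ∪ bad2 t)
  have hbm : MeasurableSet bad :=
    Finset.measurableSet_biUnion _ fun t _ => (hb1m t).union (hb2m t)
  have hbad : μ.real bad ≤ errorBound α (Fintype.card ι) ρ ε δ := by
    refine (measureReal_biUnion_finset_le _ _).trans ((Finset.sum_le_sum fun t _ =>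
      (measureReal_union_le _ _).trans (add_le_add (measureReal_pi_two_large_le hν hk hε t)
        (measureReal_pi_sum_trunc_le hν hα2 hρ hk hε hδ t))).trans (le_of_eq ?_))
    rw [Finset.sum_const, Finset.card_univ, nsmul_eq_mul, errorBound]
  have hpt (x : Fin k → ι → ℝ) : |h ‖a • ∑ i, x i‖ - h (a * ‖x‖)|
      ≤ L * (δ + ε) + bad.indicator (fun _ => H) x := by
    by_cases hx : x ∈ bad
    · rw [Set.indicator_of_mem hx]
      have := hH ‖a • ∑ i, x i‖ (a * ‖x‖)
      rw [Real.dist_eq] at this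
      have : 0 ≤ L * (δ + ε) := by positivity
      linarith
    · rw [Set.indicator_of_notMem hx, add_zero]
      simp only [bad, bad1, bad2, Finset.mem_univ, Set.iUnion_true, Set.mem_iUnion, Set.mem_union,
        Set.mem_ofPred_eq, not_exists, not_or, not_and, not_lt] at hx
      have hcomp := abs_norm_sum_sub_norm_le (fun i => a • x i) hε.le hδ.le
        (fun t i j hi hj => by
          by_contra hij
          exact (not_le.2 hj) ((hx t).1 i j hij hi))
        (fun t => (hx t).2)
      have h1 : (∑ i, a • x i) = a • ∑ i, x i := (Finset.smul_sum).symm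
      have h2 : ‖fun i => a • x i‖ = a * ‖x‖ := by
        have : (fun i => a • x i) = a • x := rfl
        rw [this, norm_smul, Real.norm_eq_abs, abs_of_pos ha]
      rw [h1, h2] at hcomp
      have h3 := hL.dist_le_mul ‖a • ∑ i, x i‖ (a * ‖x‖)
      rw [Real.dist_eq, Real.dist_eq] at h3
      exact h3.trans (mul_le_mul_of_nonneg_left hcomp L.2)
  rw [hfr, ← integral_sub hi1 hi2]
  have hibad : Integrable (bad.indicator fun _ => H) μ := (integrable_const H).indicator hbm
  calc |∫ x, (h ‖a • ∑ i, x i‖ - h (a * ‖x‖)) ∂μ|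
      ≤ ∫ x, |h ‖a • ∑ i, x i‖ - h (a * ‖x‖)| ∂μ := abs_integral_le_integral_abs
    _ ≤ ∫ x, (L * (δ + ε) + bad.indicator (fun _ => H) x) ∂μ :=
        integral_mono (hi1.sub hi2).abs ((integrable_const _).add hibad) hpt
    _ = L * (δ + ε) + H * μ.real bad := by
        rw [integral_add (integrable_const _) hibad, integral_indicator_const _ hbm]
        simp [mul_comm]
    _ ≤ _ := by gcongr

end Comparison

/-! ### A heavy-tailed law with prescribed directions -/

section Symmetrization

variable {ι : Type*}

/-- The symmetrization of a law on `ℝ^ι`: multiplication by an independent fair random sign. -/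
noncomputable def symmetrize (ν : Measure (ι → ℝ)) : Measure (ι → ℝ) :=
  (2⁻¹ : ENNReal) • (ν + ν.map Neg.neg)

theorem map_symmetrize {β : Type*} [MeasurableSpace β] (ν : Measure (ι → ℝ)) {g : (ι → ℝ) → β}
    (hg : Measurable g) (heven : ∀ x, g (-x) = g x) : (symmetrize ν).map g = ν.map g := by
  have h : (ν.map Neg.neg).map g = ν.map g := by
    rw [Measure.map_map hg measurable_neg]
    congr 1
    exact funext heven
  rw [symmetrize, Measure.map_smul, Measure.map_add _ _ hg, h, ← two_smul ENNReal, smul_smul,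
    ENNReal.inv_mul_cancel two_ne_zero ENNReal.ofNat_ne_top, one_smul]

theorem symmetrize_map_neg (ν : Measure (ι → ℝ)) :
    (symmetrize ν).map Neg.neg = symmetrize ν := by
  have h : (ν.map Neg.neg).map Neg.neg = ν := by
    rw [Measure.map_map measurable_neg measurable_neg]
    simp
  rw [symmetrize, Measure.map_smul, Measure.map_add _ _ measurable_neg, h, add_comm]

instance isProbabilityMeasure_symmetrize (ν : Measure (ι → ℝ)) [IsProbabilityMeasure ν] :
    IsProbabilityMeasure (symmetrize ν) := by
  constructor
  have h : ν.map Neg.neg Set.univ = 1 := by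
    rw [Measure.map_apply measurable_neg .univ, Set.preimage_univ, measure_univ]
  rw [symmetrize, Measure.smul_apply, Measure.add_apply, h, measure_univ, one_add_one_eq_two,
    smul_eq_mul, ENNReal.inv_mul_cancel two_ne_zero ENNReal.ofNat_ne_top]

theorem integral_symmetrize (ν : Measure (ι → ℝ)) {g : (ι → ℝ) → ℝ} (hg : Measurable g)
    (heven : ∀ x, g (-x) = g x) : ∫ x, g x ∂(symmetrize ν) = ∫ x, g x ∂ν := by
  have h1 := integral_map (μ := symmetrize ν) hg.aemeasurable
    (f := id) measurable_id.aestronglyMeasurable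
  have h2 := integral_map (μ := ν) hg.aemeasurable (f := id) measurable_id.aestronglyMeasurable
  rw [map_symmetrize ν hg heven] at h1
  exact h1.symm.trans h2

end Symmetrization

/-- The exponential law of rate one, as a density on the half-line. -/
noncomputable def expLaw : Measure ℝ :=
  (volume.restrict (Set.Ioi 0)).withDensity fun z => ENNReal.ofReal (Real.exp (-z))

theorem measurable_ofReal_exp_neg : Measurable fun z : ℝ => ENNReal.ofReal (Real.exp (-z)) := by
  fun_prop

theorem expLaw_Ici {r : ℝ} (hr : 0 ≤ r) :
    expLaw (Set.Ici r) = ENNReal.ofReal (Real.exp (-r)) := by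
  rw [expLaw, withDensity_apply _ measurableSet_Ici, Measure.restrict_restrict measurableSet_Ici]
  have h : (Set.Ici r ∩ Set.Ioi 0 : Set ℝ) =ᵐ[volume] Set.Ioi r := by
    filter_upwards [Measure.ae_ne volume r] with z hz
    refine propext ⟨fun h => lt_of_le_of_ne h.1 (Ne.symm hz), fun h => ⟨le_of_lt h, hr.trans_lt h⟩⟩
  rw [Measure.restrict_congr_set h, ← ofReal_integral_eq_lintegral_ofReal
    (integrableOn_exp_neg_Ioi r) (.of_forall fun z => (Real.exp_pos _).le), integral_exp_neg_Ioi]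

theorem expLaw_le : expLaw ≤ volume.restrict (Set.Ioi 0) := by
  refine Measure.le_iff.2 fun A hA => ?_
  rw [expLaw, withDensity_apply _ hA, ← setLIntegral_one]
  refine lintegral_mono_ae (ae_restrict_of_ae_restrict_of_subset (Set.subset_univ A) ?_)
  rw [Measure.restrict_univ]
  filter_upwards [ae_restrict_mem measurableSet_Ioi] with z hz
  rw [← ENNReal.ofReal_one]
  exact ENNReal.ofReal_le_ofReal (Real.exp_le_one_iff.2 (neg_nonpos.2 (le_of_lt hz)))

theorem ae_expLaw_pos : ∀ᵐ z ∂expLaw, 0 < z :=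
  (withDensity_absolutelyContinuous _ _).ae_le (ae_restrict_mem measurableSet_Ioi)

instance isProbabilityMeasure_expLaw : IsProbabilityMeasure expLaw := by
  constructor
  have h : (Set.univ : Set ℝ) =ᵐ[expLaw] Set.Ici 0 := by
    filter_upwards [ae_expLaw_pos] with z hz
    exact propext ⟨fun _ => le_of_lt hz, fun _ => trivial⟩
  rw [measure_congr h, expLaw_Ici le_rfl]
  simp

theorem integral_expLaw (g : ℝ → ℝ) :
    ∫ z, g z ∂expLaw = ∫ z in Set.Ioi 0, Real.exp (-z) * g z := by
  rw [expLaw, integral_withDensity_eq_integral_toReal_smul measurable_ofReal_exp_neg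
    (.of_forall fun z => ENNReal.ofReal_lt_top)]
  simp [ENNReal.toReal_ofReal (Real.exp_pos _).le]

theorem rpow_neg_inv_le_iff {α : ℝ} (hα : 0 < α) {z r : ℝ} (hz : 0 < z) (hr : 0 < r) :
    z ^ (-(1 / α)) ≤ r ↔ r ^ (-α) ≤ z := by
  have h : r = (r ^ (-α)) ^ (-(1 / α)) := by
    rw [← Real.rpow_mul hr.le]
    have : -α * -(1 / α) = 1 := by field_simp
    rw [this, Real.rpow_one]
  conv_lhs => rw [h]
  exact Real.rpow_le_rpow_iff_of_neg hz (Real.rpow_pos_of_pos hr _) (by simpa using hα)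

/-- The power `Z^{-1/α}` of an exponential variable has the Fréchet law. -/
theorem map_expLaw {α : ℝ} (hα : 0 < α) :
    expLaw.map (fun z => z ^ (-(1 / α))) = frechet α hα := by
  have hm : Measurable fun z : ℝ => z ^ (-(1 / α)) := by fun_prop
  have := Measure.isProbabilityMeasure_map (μ := expLaw) hm.aemeasurable
  refine Measure.ext_of_Iic _ _ fun r => ?_
  rw [Measure.map_apply hm measurableSet_Iic, frechet_Iic]
  split_ifs with hr
  · rw [← expLaw_Ici (by positivity)]
    refine measure_congr ?_
    filter_upwards [ae_expLaw_pos] with z hz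
    exact propext (rpow_neg_inv_le_iff hα hz hr)
  · rw [ENNReal.ofReal_zero, measure_eq_zero_iff_ae_notMem]
    filter_upwards [ae_expLaw_pos] with z hz h
    exact hr ((Real.rpow_pos_of_pos hz _).trans_le h)

section Spherical

variable {ι : Type*} [Fintype ι] {α : ℝ}

/-- The law of `± Z^{-1/α} V`, where the sign is fair, `Z` is exponential, `V` has the law `τ`, and
the three are independent. -/
noncomputable def radialLaw (α : ℝ) (τ : Measure (ι → ℝ)) : Measure (ι → ℝ) :=
  symmetrize ((expLaw.prod τ).map fun p => p.1 ^ (-(1 / α)) • p.2)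

theorem measurable_radial (α : ℝ) :
    Measurable fun p : ℝ × (ι → ℝ) => p.1 ^ (-(1 / α)) • p.2 :=
  (measurable_fst.pow_const _).smul measurable_snd

instance isProbabilityMeasure_radialLaw (α : ℝ) (τ : Measure (ι → ℝ)) [IsProbabilityMeasure τ] :
    IsProbabilityMeasure (radialLaw α τ) := by
  have := Measure.isProbabilityMeasure_map (μ := expLaw.prod τ)
    (measurable_radial (ι := ι) α).aemeasurable
  exact isProbabilityMeasure_symmetrize _

theorem integral_radialLaw (τ : Measure (ι → ℝ)) {g : (ι → ℝ) → ℝ} (hg : Measurable g)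
    (heven : ∀ x, g (-x) = g x) :
    ∫ x, g x ∂(radialLaw α τ) = ∫ p, g (p.1 ^ (-(1 / α)) • p.2) ∂(expLaw.prod τ) := by
  rw [radialLaw, integral_symmetrize _ hg heven,
    integral_map (measurable_radial α).aemeasurable hg.aestronglyMeasurable]

theorem radialLaw_tail (hα : 0 < α) {τ : Measure (ι → ℝ)} [IsProbabilityMeasure τ] {ρ : ℝ}
    (hρ : 0 ≤ ρ) {t : ι} (hτ : ∫⁻ v, ENNReal.ofReal (|v t| ^ α) ∂τ ≤ ENNReal.ofReal ρ) {r : ℝ}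
    (hr : 0 < r) : (radialLaw α τ).real {x | r < |x t|} ≤ ρ * r ^ (-α) := by
  have hm : Measurable fun x : ι → ℝ => |x t| := (measurable_pi_apply t).norm
  have hset : MeasurableSet {p : ℝ × (ι → ℝ) | r < |(p.1 ^ (-(1 / α)) • p.2) t|} :=
    measurableSet_lt measurable_const (hm.comp (measurable_radial α))
  have h1 : radialLaw α τ {x | r < |x t|}
      = (expLaw.prod τ) {p | r < |(p.1 ^ (-(1 / α)) • p.2) t|} := by
    calc radialLaw α τ {x | r < |x t|} = ((radialLaw α τ).map fun x => |x t|) (Set.Ioi r) :=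
          (Measure.map_apply hm measurableSet_Ioi).symm
      _ = _ := by
          rw [radialLaw, map_symmetrize _ hm (by simp), Measure.map_map hm (measurable_radial α),
            Measure.map_apply (hm.comp (measurable_radial α)) measurableSet_Ioi]
          rfl
  have hinner (v : ι → ℝ) : expLaw ((fun z => (z, v)) ⁻¹'
      {p : ℝ × (ι → ℝ) | r < |(p.1 ^ (-(1 / α)) • p.2) t|})
      ≤ ENNReal.ofReal (r ^ (-α)) * ENNReal.ofReal (|v t| ^ α) := by
    rw [← ENNReal.ofReal_mul (by positivity)]
    calc _ ≤ (volume.restrict (Set.Ioi 0)) ((fun z => (z, v)) ⁻¹'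
          {p : ℝ × (ι → ℝ) | r < |(p.1 ^ (-(1 / α)) • p.2) t|}) := expLaw_le _
      _ ≤ volume (Set.Ioc 0 (r ^ (-α) * |v t| ^ α)) := by
          rw [Measure.restrict_apply (hset.preimage (by fun_prop))]
          refine measure_mono ?_
          rintro z ⟨hz1, hz2⟩
          have hz : (0 : ℝ) < z := hz2
          simp only [Set.mem_preimage, Set.mem_ofPred_eq, Pi.smul_apply, smul_eq_mul, abs_mul,
            abs_of_pos (Real.rpow_pos_of_pos hz _)] at hz1
          have hv : 0 < |v t| := by
            by_contra h
            have h0 : |v t| = 0 := le_antisymm (not_lt.1 h) (abs_nonneg _)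
            rw [h0, mul_zero] at hz1
            exact hr.not_gt hz1
          have h2 : ¬ z ^ (-(1 / α)) ≤ r / |v t| := by
            rw [le_div_iff₀ hv]; exact not_le.2 hz1
          rw [rpow_neg_inv_le_iff hα hz (by positivity), not_le, Real.div_rpow hr.le hv.le,
            Real.rpow_neg hv.le, div_inv_eq_mul] at h2
          exact ⟨hz, h2.le⟩
      _ = _ := by simp
  rw [Measure.real, h1, Measure.prod_apply_symm hset]
  refine ENNReal.toReal_le_of_le_ofReal (by positivity) ?_
  calc _ ≤ ∫⁻ v, ENNReal.ofReal (r ^ (-α)) * ENNReal.ofReal (|v t| ^ α) ∂τ := lintegral_mono hinner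
    _ = ENNReal.ofReal (r ^ (-α)) * ∫⁻ v, ENNReal.ofReal (|v t| ^ α) ∂τ :=
        lintegral_const_mul _ (by fun_prop)
    _ ≤ ENNReal.ofReal (r ^ (-α)) * ENNReal.ofReal ρ := by gcongr
    _ = _ := by rw [← ENNReal.ofReal_mul (by positivity), mul_comm]

/-- The truncated second moment of `Z^{-1/α} w` for a real number `w`. -/
theorem lintegral_sq_trunc_le (hα : 0 < α) (hα2 : α < 2) {r : ℝ} (hr : 0 < r) (w : ℝ) :
    ∫⁻ z, ENNReal.ofReal (trunc r (z ^ (-(1 / α)) * w) ^ 2) ∂expLaw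
      ≤ ENNReal.ofReal (α / (2 - α) * r ^ (2 - α) * |w| ^ α) := by
  have h2α : 0 < 2 - α := by linarith
  by_cases hw : w = 0
  · simp [hw, trunc]
  have hw' : 0 < |w| := abs_pos.2 hw
  set z₀ := (|w| / r) ^ α with hz₀
  have hz₀pos : 0 < z₀ := by positivity
  have hexp : -(2 / α) < -1 := by
    rw [neg_lt_neg_iff, lt_div_iff₀ hα]; linarith
  have hint : IntegrableOn (fun z : ℝ => w ^ 2 * z ^ (-(2 / α))) (Set.Ioi z₀) :=
    (integrableOn_Ioi_rpow_of_lt hexp hz₀pos).const_mul _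
  calc ∫⁻ z, ENNReal.ofReal (trunc r (z ^ (-(1 / α)) * w) ^ 2) ∂expLaw
      ≤ ∫⁻ z in Set.Ioi 0, ENNReal.ofReal (trunc r (z ^ (-(1 / α)) * w) ^ 2) :=
        lintegral_mono' expLaw_le le_rfl
    _ ≤ ∫⁻ z, (Set.Ici z₀).indicator (fun z => ENNReal.ofReal (w ^ 2 * z ^ (-(2 / α)))) z := by
        rw [← lintegral_indicator measurableSet_Ioi]
        refine lintegral_mono fun z => ?_
        by_cases hz : z ∈ Set.Ioi (0 : ℝ)
        swap
        · simp [Set.indicator_of_notMem hz]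
        rw [Set.indicator_of_mem hz, trunc]
        have hz' : (0 : ℝ) < z := hz
        split_ifs with h
        · rw [abs_mul, abs_of_pos (Real.rpow_pos_of_pos hz' _), ← le_div_iff₀ hw',
            rpow_neg_inv_le_iff hα hz' (by positivity), Real.rpow_neg (by positivity),
            ← Real.inv_rpow (by positivity), inv_div] at h
          rw [Set.indicator_of_mem (show z ∈ Set.Ici z₀ from h), mul_pow, ← Real.rpow_natCast,
            ← Real.rpow_mul hz'.le, mul_comm]
          refine le_of_eq ?_
          congr 3
          push_cast
          ring
        · simp
    _ = ∫⁻ z in Set.Ioi z₀, ENNReal.ofReal (w ^ 2 * z ^ (-(2 / α))) := by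
        rw [lintegral_indicator measurableSet_Ici, Measure.restrict_congr_set Ioi_ae_eq_Ici]
    _ = ENNReal.ofReal (∫ z in Set.Ioi z₀, w ^ 2 * z ^ (-(2 / α))) := by
        refine (ofReal_integral_eq_lintegral_ofReal hint ?_).symm
        filter_upwards [ae_restrict_mem measurableSet_Ioi] with z hz
        have : 0 < z := hz₀pos.trans hz
        positivity
    _ ≤ _ := by
        refine ENNReal.ofReal_le_ofReal (le_of_eq ?_)
        rw [integral_const_mul, integral_Ioi_rpow_of_lt hexp hz₀pos]
        have h1 : z₀ ^ (-(2 / α) + 1) = |w| ^ α / |w| ^ 2 * r ^ (2 - α) := by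
          rw [hz₀, ← Real.rpow_mul (by positivity)]
          have : α * (-(2 / α) + 1) = α - 2 := by field_simp; ring
          rw [this, Real.div_rpow hw'.le hr.le, Real.rpow_sub hw', Real.rpow_sub hr,
            Real.rpow_sub hr]
          norm_num
          field_simp
        have h2 : -(2 / α) + 1 = -((2 - α) / α) := by field_simp; ring
        rw [h1, sq_abs, h2]
        field_simp

theorem radialLaw_sq_trunc (hα : 0 < α) (hα2 : α < 2) {τ : Measure (ι → ℝ)}
    [IsProbabilityMeasure τ] {ρ : ℝ} (hρ : 0 ≤ ρ) {t : ι}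
    (hτ : ∫⁻ v, ENNReal.ofReal (|v t| ^ α) ∂τ ≤ ENNReal.ofReal ρ) {r : ℝ} (hr : 0 < r) :
    ∫ x, trunc r (x t) ^ 2 ∂(radialLaw α τ) ≤ α / (2 - α) * (ρ * r ^ (2 - α)) := by
  have h2α : 0 < 2 - α := by linarith
  have hm : Measurable fun x : ι → ℝ => trunc r (x t) ^ 2 :=
    ((measurable_trunc r).comp (measurable_pi_apply t)).pow_const 2
  rw [integral_radialLaw τ hm fun x => by simp [trunc_neg]]
  have hm' : Measurable fun p : ℝ × (ι → ℝ) => trunc r ((p.1 ^ (-(1 / α)) • p.2) t) ^ 2 :=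
    hm.comp (measurable_radial α)
  rw [integral_eq_lintegral_of_nonneg_ae (.of_forall fun p => sq_nonneg _)
    hm'.aestronglyMeasurable, lintegral_prod_symm _ hm'.ennreal_ofReal.aemeasurable]
  refine ENNReal.toReal_le_of_le_ofReal (by positivity) ?_
  calc _ ≤ ∫⁻ v : ι → ℝ, ENNReal.ofReal (α / (2 - α) * r ^ (2 - α))
            * ENNReal.ofReal (|v t| ^ α) ∂τ := by
        refine lintegral_mono fun v => ?_
        rw [← ENNReal.ofReal_mul (by positivity)]
        exact lintegral_sq_trunc_le hα hα2 hr (v t)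
    _ = ENNReal.ofReal (α / (2 - α) * r ^ (2 - α)) * ∫⁻ v, ENNReal.ofReal (|v t| ^ α) ∂τ :=
        lintegral_const_mul _ (by fun_prop)
    _ ≤ ENNReal.ofReal (α / (2 - α) * r ^ (2 - α)) * ENNReal.ofReal ρ := by gcongr
    _ = _ := by
        rw [← ENNReal.ofReal_mul (by positivity)]
        congr 1
        ring

theorem isHeavyTailed_radialLaw (hα : 0 < α) (hα2 : α < 2) {τ : Measure (ι → ℝ)}
    [IsProbabilityMeasure τ] (hτ1 : ∀ᵐ v ∂τ, ‖v‖ = 1) {ρ : ℝ} (hρ : 0 ≤ ρ)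
    (hτ : ∀ t, ∫⁻ v, ENNReal.ofReal (|v t| ^ α) ∂τ ≤ ENNReal.ofReal ρ) :
    IsHeavyTailed α hα (radialLaw α τ) ρ where
  map_neg := symmetrize_map_neg _
  map_norm := by
    rw [radialLaw, map_symmetrize _ measurable_norm norm_neg,
      Measure.map_map measurable_norm (measurable_radial α), ← map_expLaw hα]
    have h1 : (norm ∘ fun p : ℝ × (ι → ℝ) => p.1 ^ (-(1 / α)) • p.2)
        =ᵐ[expLaw.prod τ] (fun z : ℝ => z ^ (-(1 / α))) ∘ Prod.fst := by
      have h2 : ∀ᵐ p ∂(expLaw.prod τ), 0 < p.1 :=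
        Measure.quasiMeasurePreserving_fst.ae ae_expLaw_pos
      have h3 : ∀ᵐ p ∂(expLaw.prod τ), ‖p.2‖ = 1 :=
        Measure.quasiMeasurePreserving_snd.ae hτ1
      filter_upwards [h2, h3] with p hp1 hp2
      simp only [Function.comp_apply]
      rw [norm_smul, hp2, mul_one, Real.norm_eq_abs, abs_of_pos (Real.rpow_pos_of_pos hp1 _)]
    rw [Measure.map_congr h1, ← Measure.map_map (by fun_prop) measurable_fst, Measure.map_fst_prod,
      measure_univ, one_smul]
  tail t r hr := radialLaw_tail hα hρ (hτ t) hr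
  sq_trunc t r hr := radialLaw_sq_trunc hα hα2 hρ (hτ t) hr

end Spherical

/-! ### Characteristic functions and the domain of attraction -/

section StableConst

variable {α : ℝ}

/-- The constant `C = ∫_0^∞ (1 - cos(z^{-1/α})) dz`, whose inverse is the tail constant of the
symmetric `α`-stable law. -/
noncomputable def stableConst (α : ℝ) : ℝ :=
  ∫ z in Set.Ioi (0 : ℝ), (1 - Real.cos (z ^ (-(1 / α))))

theorem one_sub_cos_nonneg (x : ℝ) : 0 ≤ 1 - Real.cos x := sub_nonneg.2 (Real.cos_le_one x)

theorem measurable_one_sub_cos_rpow (α : ℝ) :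
    Measurable fun z : ℝ => 1 - Real.cos (z ^ (-(1 / α))) := by fun_prop

theorem integrableOn_one_sub_cos (hα : 0 < α) (hα2 : α < 2) :
    IntegrableOn (fun z : ℝ => 1 - Real.cos (z ^ (-(1 / α)))) (Set.Ioi 0) := by
  have hm := (measurable_one_sub_cos_rpow α).aestronglyMeasurable (μ := volume)
  rw [← Set.Ioc_union_Ioi_eq_Ioi (zero_le_one' ℝ)]
  refine IntegrableOn.union ?_ ?_
  · refine Integrable.mono' (g := fun _ => 2) (by simp) hm.restrict (.of_forall fun z => ?_)
    rw [Real.norm_eq_abs, abs_of_nonneg (one_sub_cos_nonneg _)]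
    linarith [Real.neg_one_le_cos (z ^ (-(1 / α)))]
  · have hexp : -(2 / α) < -1 := by
      rw [neg_lt_neg_iff, lt_div_iff₀ hα]; linarith
    refine Integrable.mono' (integrableOn_Ioi_rpow_of_lt hexp one_pos) hm.restrict ?_
    filter_upwards [ae_restrict_mem measurableSet_Ioi] with z hz
    have hz' : (0 : ℝ) < z := zero_lt_one.trans hz
    rw [Real.norm_eq_abs, abs_of_nonneg (one_sub_cos_nonneg _)]
    have h1 := Real.one_sub_sq_div_two_le_cos (x := z ^ (-(1 / α)))
    have h2 : (z ^ (-(1 / α))) ^ 2 = z ^ (-(2 / α)) := by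
      rw [← Real.rpow_natCast, ← Real.rpow_mul hz'.le]
      congr 1
      push_cast
      ring
    rw [h2] at h1
    linarith [Real.rpow_pos_of_pos hz' (-(2 / α))]

theorem stableConst_pos (hα : 0 < α) (hα2 : α < 2) : 0 < stableConst α := by
  rw [stableConst, setIntegral_pos_iff_support_of_nonneg_ae
    (.of_forall fun z => one_sub_cos_nonneg _) (integrableOn_one_sub_cos hα hα2)]
  refine lt_of_lt_of_le ?_ (measure_mono (s := Set.Ioo (1 : ℝ) 2) ?_)
  · simp
  · intro z hz
    have hz0 : 0 < z := zero_lt_one.trans hz.1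
    refine ⟨?_, hz0⟩
    have h1 : 0 < z ^ (-(1 / α)) := Real.rpow_pos_of_pos hz0 _
    have h2 : z ^ (-(1 / α)) < 1 :=
      Real.rpow_lt_one_of_one_lt_of_neg hz.1 (by rw [neg_lt_zero]; positivity)
    have h3 : Real.cos (z ^ (-(1 / α))) < Real.cos 0 :=
      Real.cos_lt_cos_of_nonneg_of_le_pi le_rfl (by linarith [Real.pi_gt_three]) h1
    rw [Real.cos_zero] at h3
    exact (sub_pos.2 h3).ne'

/-- One minus the characteristic function of `± Z^{-1/α}`, where `Z` is exponential. -/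
noncomputable def radialExponent (α u : ℝ) : ℝ :=
  ∫ z, (1 - Real.cos (u * z ^ (-(1 / α)))) ∂expLaw

theorem radialExponent_nonneg (u : ℝ) : 0 ≤ radialExponent α u :=
  integral_nonneg fun _ => one_sub_cos_nonneg _

theorem radialExponent_abs (u : ℝ) : radialExponent α |u| = radialExponent α u := by
  unfold radialExponent
  refine integral_congr_ae (.of_forall fun z => ?_)
  rcases abs_choice u with h | h <;> simp [h]

theorem radialExponent_zero : radialExponent α 0 = 0 := by simp [radialExponent]

theorem radialExponent_eq (hα : 0 < α) {u : ℝ} (hu : 0 < u) :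
    radialExponent α u
      = u ^ α * ∫ z in Set.Ioi 0, Real.exp (-(u ^ α * z)) * (1 - Real.cos (z ^ (-(1 / α)))) := by
  have hp : 0 < u ^ α := by positivity
  have h := integral_comp_mul_left_Ioi
    (fun z => Real.exp (-z) * (1 - Real.cos (u * z ^ (-(1 / α))))) 0 hp
  rw [mul_zero, smul_eq_mul] at h
  rw [radialExponent, integral_expLaw, ← mul_inv_cancel_left₀ hp.ne'
    (∫ z in Set.Ioi 0, Real.exp (-z) * (1 - Real.cos (u * z ^ (-(1 / α))))), ← h]
  congr 1
  refine setIntegral_congr_fun measurableSet_Ioi fun z hz => ?_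
  have hz' : (0 : ℝ) < z := hz
  have h1 : u * (u ^ α * z) ^ (-(1 / α)) = z ^ (-(1 / α)) := by
    rw [Real.mul_rpow hp.le hz'.le, ← Real.rpow_mul hu.le]
    have : α * -(1 / α) = -1 := by field_simp
    rw [this, Real.rpow_neg_one, mul_inv_cancel_left₀ hu.ne']
  simp only [h1]

theorem norm_exp_mul_le {p z : ℝ} (hp : 0 ≤ p) (hz : 0 < z) :
    ‖Real.exp (-(p * z)) * (1 - Real.cos (z ^ (-(1 / α))))‖
      ≤ 1 - Real.cos (z ^ (-(1 / α))) := by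
  rw [Real.norm_eq_abs, abs_of_nonneg (mul_nonneg (Real.exp_pos _).le (one_sub_cos_nonneg _))]
  refine mul_le_of_le_one_left (one_sub_cos_nonneg _) (Real.exp_le_one_iff.2 ?_)
  have := mul_nonneg hp hz.le
  linarith

theorem radialExponent_le (hα : 0 < α) (hα2 : α < 2) (u : ℝ) :
    radialExponent α u ≤ stableConst α * |u| ^ α := by
  rw [← radialExponent_abs]
  rcases (abs_nonneg u).eq_or_lt with hu | hu
  · rw [← hu, radialExponent_zero, Real.zero_rpow hα.ne', mul_zero]
  rw [radialExponent_eq hα hu, mul_comm]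
  refine mul_le_mul_of_nonneg_right ?_ (by positivity)
  refine integral_mono_of_nonneg (.of_forall fun z =>
    mul_nonneg (Real.exp_pos _).le (one_sub_cos_nonneg _)) (integrableOn_one_sub_cos hα hα2) ?_
  filter_upwards [ae_restrict_mem measurableSet_Ioi] with z hz
  exact (le_abs_self _).trans (norm_exp_mul_le (by positivity) hz)

theorem rpow_neg_inv_mul_rpow (hα : 0 < α) {k : ℕ} (hk : 0 < k) {u : ℝ} (hu : 0 ≤ u) :
    ((k : ℝ) ^ (-(1 / α)) * u) ^ α = u ^ α / k := by
  have hk' : (0 : ℝ) < k := by exact_mod_cast hk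
  rw [Real.mul_rpow (by positivity) hu, ← Real.rpow_mul hk'.le]
  have : -(1 / α) * α = -1 := by field_simp
  rw [this, Real.rpow_neg_one, mul_comm, div_eq_mul_inv]

theorem mul_radialExponent_le (hα : 0 < α) (hα2 : α < 2) (k : ℕ) (u : ℝ) :
    k * radialExponent α ((k : ℝ) ^ (-(1 / α)) * u) ≤ stableConst α * |u| ^ α := by
  have hC := (stableConst_pos hα hα2).le
  rcases Nat.eq_zero_or_pos k with rfl | hk
  · rw [Nat.cast_zero, zero_mul]; positivity
  have hk' : (0 : ℝ) < k := by exact_mod_cast hk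
  have h := radialExponent_le hα hα2 ((k : ℝ) ^ (-(1 / α)) * u)
  rw [abs_mul, abs_of_pos (Real.rpow_pos_of_pos hk' _),
    rpow_neg_inv_mul_rpow hα hk (abs_nonneg u)] at h
  calc _ ≤ k * (stableConst α * (|u| ^ α / k)) := mul_le_mul_of_nonneg_left h hk'.le
    _ = _ := by field_simp

theorem tendsto_mul_radialExponent (hα : 0 < α) (hα2 : α < 2) (u : ℝ) :
    Tendsto (fun k : ℕ => k * radialExponent α ((k : ℝ) ^ (-(1 / α)) * u)) atTop
      (𝓝 (stableConst α * |u| ^ α)) := by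
  rcases (abs_nonneg u).eq_or_lt with hu | hu
  · rw [← hu, abs_eq_zero.1 hu.symm, Real.zero_rpow hα.ne']
    simp [radialExponent_zero]
  have hlim : Tendsto (fun k : ℕ => ∫ z in Set.Ioi 0,
      Real.exp (-(|u| ^ α / k * z)) * (1 - Real.cos (z ^ (-(1 / α))))) atTop
      (𝓝 (stableConst α)) := by
    refine tendsto_integral_of_dominated_convergence
      (fun z : ℝ => 1 - Real.cos (z ^ (-(1 / α)))) (fun k => by fun_prop)
      (integrableOn_one_sub_cos hα hα2) (fun k => ?_) (.of_forall fun z => ?_)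
    · filter_upwards [ae_restrict_mem measurableSet_Ioi] with z hz
      exact norm_exp_mul_le (by positivity) hz
    · have h1 : Tendsto (fun k : ℕ => -(|u| ^ α / k * z)) atTop (𝓝 0) := by
        simpa using ((tendsto_const_div_atTop_nhds_zero_nat (|u| ^ α)).mul_const z).neg
      have h2 := (Real.continuous_exp.tendsto 0).comp h1
      rw [Real.exp_zero] at h2
      simpa using h2.mul_const (1 - Real.cos (z ^ (-(1 / α))))
  have h := hlim.mul_const (|u| ^ α)
  refine h.congr' ?_
  filter_upwards [eventually_gt_atTop 0] with k hk
  have hk' : (0 : ℝ) < k := by exact_mod_cast hk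
  have hk1 : 0 < (k : ℝ) ^ (-(1 / α)) := Real.rpow_pos_of_pos hk' _
  rw [← radialExponent_abs, abs_mul, abs_of_pos hk1, radialExponent_eq hα (by positivity),
    rpow_neg_inv_mul_rpow hα hk hu.le]
  field_simp

end StableConst

section DomainOfAttraction

variable {ι : Type*} [Fintype ι] {α : ℝ} {τ : Measure (ι → ℝ)} [IsProbabilityMeasure τ]

theorem measurable_linearForm (θ : ι → ℝ) : Measurable fun x : ι → ℝ => ∑ t, θ t * x t := by
  fun_prop

theorem measurable_radialExponent : Measurable (radialExponent α) := by
  have h : StronglyMeasurable fun p : ℝ × ℝ => 1 - Real.cos (p.1 * p.2 ^ (-(1 / α))) :=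
    (by fun_prop : Measurable fun p : ℝ × ℝ =>
      1 - Real.cos (p.1 * p.2 ^ (-(1 / α)))).stronglyMeasurable
  exact (h.integral_prod_right (ν := expLaw)).measurable

theorem radialExponent_le_two (u : ℝ) : radialExponent α u ≤ 2 := by
  have h : ∫ _z, (2 : ℝ) ∂expLaw = 2 := by simp
  rw [radialExponent, ← h]
  refine integral_mono_of_nonneg (.of_forall fun z => one_sub_cos_nonneg _) (integrable_const _)
    (.of_forall fun z => ?_)
  dsimp only
  linarith [Real.neg_one_le_cos (u * z ^ (-(1 / α)))]

theorem integrable_radialExponent (θ : ι → ℝ) :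
    Integrable (fun v : ι → ℝ => radialExponent α (∑ t, θ t * v t)) τ :=
  integrable_of_abs_le (measurable_radialExponent.comp (measurable_linearForm θ)) (K := 2)
    fun v => by
      rw [abs_of_nonneg (radialExponent_nonneg _)]
      exact radialExponent_le_two _

theorem integral_cexp_radialLaw (θ : ι → ℝ) :
    ∫ x, Complex.exp (((∑ t, θ t * x t : ℝ) : ℂ) * Complex.I) ∂(radialLaw α τ)
      = 1 - ((∫ v, radialExponent α (∑ t, θ t * v t) ∂τ : ℝ) : ℂ) := by
  have hl := measurable_linearForm θ
  have hneg (x : ι → ℝ) : ∑ t, θ t * (-x) t = -∑ t, θ t * x t := by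
    simp
  have hcm : Measurable fun x : ι → ℝ => Real.cos (∑ t, θ t * x t) := hl.cos
  have hsm : Measurable fun x : ι → ℝ => Real.sin (∑ t, θ t * x t) := hl.sin
  have hci : Integrable (fun x : ι → ℝ => Real.cos (∑ t, θ t * x t)) (radialLaw α τ) :=
    integrable_of_abs_le hcm fun x => Real.abs_cos_le_one _
  have hsi : Integrable (fun x : ι → ℝ => Real.sin (∑ t, θ t * x t)) (radialLaw α τ) :=
    integrable_of_abs_le hsm fun x => Real.abs_sin_le_one _
  have hsin : ∫ x, Real.sin (∑ t, θ t * x t) ∂(radialLaw α τ) = 0 := by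
    have h1 : ∫ x, Real.sin (∑ t, θ t * x t) ∂(radialLaw α τ)
        = ∫ x, -Real.sin (∑ t, θ t * x t) ∂(radialLaw α τ) := by
      conv_lhs => rw [radialLaw, ← symmetrize_map_neg, ← radialLaw]
      rw [integral_map measurable_neg.aemeasurable hsm.aestronglyMeasurable]
      simp only [hneg, Real.sin_neg]
    rw [integral_neg] at h1
    linarith
  have hcos : ∫ x, Real.cos (∑ t, θ t * x t) ∂(radialLaw α τ)
      = 1 - ∫ v, radialExponent α (∑ t, θ t * v t) ∂τ := by
    rw [integral_radialLaw τ hcm fun x => by rw [hneg, Real.cos_neg]]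
    have hm : Measurable fun p : ℝ × (ι → ℝ) =>
        Real.cos (∑ t, θ t * (p.1 ^ (-(1 / α)) • p.2) t) := hcm.comp (measurable_radial α)
    have hi := integrable_of_abs_le (P := expLaw.prod τ) hm fun x => Real.abs_cos_le_one _
    rw [integral_prod_symm _ hi]
    have hinner (v : ι → ℝ) : ∫ z, Real.cos (∑ t, θ t * (z ^ (-(1 / α)) • v) t) ∂expLaw
        = 1 - radialExponent α (∑ t, θ t * v t) := by
      have h1 (z : ℝ) : ∑ t, θ t * (z ^ (-(1 / α)) • v) t
          = (∑ t, θ t * v t) * z ^ (-(1 / α)) := by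
        rw [Finset.sum_mul]
        exact Finset.sum_congr rfl fun t _ => by simp only [Pi.smul_apply, smul_eq_mul]; ring
      simp only [h1]
      rw [radialExponent, integral_sub (integrable_const _)
        (integrable_of_abs_le (by fun_prop) fun z => Real.abs_cos_le_one _)]
      simp
    simp only [hinner]
    rw [integral_sub (integrable_const _) (integrable_radialExponent θ)]
    simp
  have hexp (x : ι → ℝ) : Complex.exp (((∑ t, θ t * x t : ℝ) : ℂ) * Complex.I)
      = ((Real.cos (∑ t, θ t * x t) : ℝ) : ℂ)
        + ((Real.sin (∑ t, θ t * x t) : ℝ) : ℂ) * Complex.I := by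
    rw [Complex.exp_mul_I, Complex.ofReal_cos, Complex.ofReal_sin]
  simp only [hexp]
  rw [integral_add hci.ofReal (hsi.ofReal.mul_const _), integral_mul_const,
    integral_complex_ofReal, integral_complex_ofReal, hsin, hcos]
  simp

/-- The characteristic functions of the normalised sums converge to that of a symmetric stable
law. -/
theorem tendsto_integral_cexp_pow (hα : 0 < α) (hα2 : α < 2) (hτ1 : ∀ᵐ v ∂τ, ‖v‖ = 1)
    (θ : ι → ℝ) :
    Tendsto (fun k : ℕ => (∫ x, Complex.exp
        (((∑ t, ((k : ℝ) ^ (-(1 / α)) * θ t) * x t : ℝ) : ℂ) * Complex.I) ∂(radialLaw α τ)) ^ k)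
      atTop (𝓝 (Real.exp (-(stableConst α * ∫ v, |∑ t, θ t * v t| ^ α ∂τ)) : ℝ)) := by
  have hC := (stableConst_pos hα hα2).le
  have hlin (a : ℝ) (v : ι → ℝ) : ∑ t, (a * θ t) * v t = a * ∑ t, θ t * v t := by
    rw [Finset.mul_sum]
    exact Finset.sum_congr rfl fun t _ => mul_assoc _ _ _
  have h1 : Tendsto (fun k : ℕ =>
      ∫ v, k * radialExponent α ((k : ℝ) ^ (-(1 / α)) * ∑ t, θ t * v t) ∂τ) atTop
      (𝓝 (∫ v, stableConst α * |∑ t, θ t * v t| ^ α ∂τ)) := by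
    refine tendsto_integral_of_dominated_convergence
      (fun _ => stableConst α * (∑ t, |θ t|) ^ α) (fun k => ?_) (integrable_const _) (fun k => ?_)
      (.of_forall fun v => tendsto_mul_radialExponent hα hα2 _)
    · exact ((measurable_radialExponent.comp
        ((measurable_linearForm θ).const_mul _)).const_mul _).aestronglyMeasurable
    · filter_upwards [hτ1] with v hv
      rw [Real.norm_eq_abs, abs_of_nonneg (mul_nonneg (Nat.cast_nonneg _)
        (radialExponent_nonneg _))]
      refine (mul_radialExponent_le hα hα2 k _).trans (mul_le_mul_of_nonneg_left ?_ hC)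
      refine Real.rpow_le_rpow (abs_nonneg _) ((Finset.abs_sum_le_sum_abs _ _).trans
        (Finset.sum_le_sum fun t _ => ?_)) hα.le
      rw [abs_mul]
      exact mul_le_of_le_one_right (abs_nonneg _) (hv ▸ norm_le_pi_norm v t)
  rw [integral_const_mul] at h1
  rw [Complex.ofReal_exp]
  refine (Complex.tendsto_one_add_pow_exp_of_tendsto (g := fun k : ℕ =>
    -((∫ v, radialExponent α ((k : ℝ) ^ (-(1 / α)) * ∑ t, θ t * v t) ∂τ : ℝ) : ℂ)) ?_).congr
    fun k => ?_
  · rw [Complex.ofReal_neg]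
    have h2 := ((Complex.continuous_ofReal.tendsto _).comp h1).neg
    refine h2.congr fun k => ?_
    simp only [Function.comp_apply]
    rw [integral_const_mul]
    push_cast
    ring
  · rw [integral_cexp_radialLaw]
    simp only [hlin, sub_eq_add_neg]

/-- The normalised sums of independent copies of a vector with the law `radialLaw α τ` converge in
distribution to the stable vector `X` with spectral measure proportional to `τ`. -/
theorem tendsto_integral_norm_sum (hα : 0 < α) (hα2 : α < 2) (hτ1 : ∀ᵐ v ∂τ, ‖v‖ = 1)
    {Ω : Type*} [MeasurableSpace Ω] {P : Measure Ω} [IsProbabilityMeasure P] {X : Ω → ι → ℝ}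
    (hX : AEMeasurable X P)
    (hchar : ∀ θ : ι → ℝ, ∫ ω, Complex.exp (((∑ t, θ t * X ω t : ℝ) : ℂ) * Complex.I) ∂P
      = (Real.exp (-(stableConst α * ∫ v, |∑ t, θ t * v t| ^ α ∂τ)) : ℝ))
    {h : ℝ → ℝ} (hh : Continuous h) {H : ℝ} (hH : ∀ u v, dist (h u) (h v) ≤ H) :
    Tendsto (fun k : ℕ => ∫ x, h ‖(k : ℝ) ^ (-(1 / α)) • ∑ i, x i‖
      ∂(Measure.pi fun _ : Fin k => radialLaw α τ)) atTop (𝓝 (∫ ω, h ‖X ω‖ ∂P)) := by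
  set E := EuclideanSpace ℝ ι
  have hsm (k : ℕ) : Measurable fun x : Fin k → ι → ℝ =>
      (WithLp.toLp 2 ((k : ℝ) ^ (-(1 / α)) • ∑ i, x i) : E) :=
    (WithLp.measurable_toLp 2 _).comp (by fun_prop)
  have hXm : AEMeasurable (fun ω => (WithLp.toLp 2 (X ω) : E)) P :=
    (WithLp.measurable_toLp 2 _).comp_aemeasurable hX
  set μ : ℕ → ProbabilityMeasure E := fun k =>
    ⟨(Measure.pi fun _ : Fin k => radialLaw α τ).map _,
      Measure.isProbabilityMeasure_map (hsm k).aemeasurable⟩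
  set μ₀ : ProbabilityMeasure E := ⟨P.map _, Measure.isProbabilityMeasure_map hXm⟩
  have hinner (y : ι → ℝ) (θ : E) : inner ℝ (WithLp.toLp 2 y : E) θ = ∑ t, θ t * y t := by
    simp [PiLp.inner_apply]
  have hconv : Tendsto μ atTop (𝓝 μ₀) := by
    refine ProbabilityMeasure.tendsto_of_tendsto_charFun fun θ => ?_
    have h0 : charFun (μ₀ : Measure E) θ
        = (Real.exp (-(stableConst α * ∫ v, |∑ t, θ t * v t| ^ α ∂τ)) : ℝ) := by
      rw [← hchar, charFun_apply]
      change ∫ x, _ ∂(P.map _) = _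
      rw [integral_map hXm (by fun_prop)]
      simp only [hinner]
    rw [h0]
    refine (tendsto_integral_cexp_pow hα hα2 hτ1 θ).congr fun k => ?_
    rw [charFun_apply]
    change _ = ∫ x, _ ∂((Measure.pi fun _ : Fin k => radialLaw α τ).map _)
    rw [integral_map (hsm k).aemeasurable (by fun_prop)]
    have hprod (x : Fin k → ι → ℝ) :
        Complex.exp ((inner ℝ (WithLp.toLp 2 ((k : ℝ) ^ (-(1 / α)) • ∑ i, x i) : E) θ : ℝ)
          * Complex.I) = ∏ i, Complex.exp
            (((∑ t, ((k : ℝ) ^ (-(1 / α)) * θ t) * x i t : ℝ) : ℂ) * Complex.I) := by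
      rw [← Complex.exp_sum, ← Finset.sum_mul, ← Complex.ofReal_sum, Finset.sum_comm, hinner]
      congr 3
      refine Finset.sum_congr rfl fun t _ => ?_
      rw [← Finset.mul_sum, Pi.smul_apply, Finset.sum_apply, smul_eq_mul]
      ring
    simp only [hprod]
    rw [integral_fintype_prod_eq_prod (fun (_ : Fin k) (x : ι → ℝ) => Complex.exp
      (((∑ t, ((k : ℝ) ^ (-(1 / α)) * θ t) * x t : ℝ) : ℂ) * Complex.I))]
    simp
  let g : BoundedContinuousFunction E ℝ :=
    { toFun := fun x => h ‖WithLp.ofLp x‖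
      continuous_toFun := hh.comp (PiLp.continuous_ofLp 2 _).norm
      map_bounded' := ⟨H, fun x y => hH _ _⟩ }
  have hg := (ProbabilityMeasure.tendsto_iff_forall_integral_tendsto.1 hconv) g
  have hgm : StronglyMeasurable g := g.continuous.stronglyMeasurable
  have e0 : ∫ x, g x ∂(μ₀ : Measure E) = ∫ ω, h ‖X ω‖ ∂P :=
    integral_map hXm hgm.aestronglyMeasurable
  have ek (k : ℕ) : ∫ x, g x ∂(μ k : Measure E) = ∫ x, h ‖(k : ℝ) ^ (-(1 / α)) • ∑ i, x i‖
      ∂(Measure.pi fun _ : Fin k => radialLaw α τ) :=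
    integral_map (hsm k).aemeasurable hgm.aestronglyMeasurable
  rw [e0] at hg
  exact hg.congr ek

/-- The maximum norm of a stable vector is almost Fréchet distributed, with an error in terms of
the moments `∫ |v t|^α dτ` of the spectral measure. -/
theorem abs_integral_norm_sub_le (hα : 0 < α) (hα2 : α < 2) (hτ1 : ∀ᵐ v ∂τ, ‖v‖ = 1) {ρ : ℝ}
    (hρ : 0 ≤ ρ) (hτ : ∀ t, ∫⁻ v, ENNReal.ofReal (|v t| ^ α) ∂τ ≤ ENNReal.ofReal ρ)
    {Ω : Type*} [MeasurableSpace Ω] {P : Measure Ω} [IsProbabilityMeasure P] {X : Ω → ι → ℝ}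
    (hX : AEMeasurable X P)
    (hchar : ∀ θ : ι → ℝ, ∫ ω, Complex.exp (((∑ t, θ t * X ω t : ℝ) : ℂ) * Complex.I) ∂P
      = (Real.exp (-(stableConst α * ∫ v, |∑ t, θ t * v t| ^ α ∂τ)) : ℝ))
    {ε δ : ℝ} (hε : 0 < ε) (hδ : 0 < δ) {h : ℝ → ℝ} {L : NNReal} {H : ℝ}
    (hL : LipschitzWith L h) (hH : ∀ u v, dist (h u) (h v) ≤ H) :
    |∫ ω, h ‖X ω‖ ∂P - ∫ z, h z ∂(frechet α hα)|
      ≤ L * (δ + ε) + H * errorBound α (Fintype.card ι) ρ ε δ := by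
  have hlim := ((tendsto_integral_norm_sum hα hα2 hτ1 hX hchar hL.continuous hH).sub_const
    (∫ z, h z ∂(frechet α hα))).abs
  refine le_of_tendsto hlim ?_
  filter_upwards [eventually_gt_atTop 0] with k hk
  exact abs_integral_norm_sum_sub_le (isHeavyTailed_radialLaw hα hα2 hτ1 hρ hτ) hα2 hρ hk hε hδ
    hL hH

end DomainOfAttraction

/-! ### The spectral measure of a stable vector -/

section Spectral

variable {S : Type*} [MeasurableSpace S] {m : Measure S} {ι : Type*} [Fintype ι] {α : ℝ}
  {F : S → ι → ℝ}

/-- The spectral measure of the kernels `F`, normalised to a probability measure: the law of the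
direction `F / ‖F‖` under the probability measure with density proportional to `‖F‖^α`. -/
noncomputable def spectralLaw (α : ℝ) (m : Measure S) (F : S → ι → ℝ) : Measure (ι → ℝ) :=
  ((∫⁻ s, ‖F s‖ₑ ^ α ∂m)⁻¹ • m.withDensity fun s => ‖F s‖ₑ ^ α).map fun s => ‖F s‖⁻¹ • F s

theorem measurable_direction (hF : Measurable F) : Measurable fun s => ‖F s‖⁻¹ • F s :=
  hF.norm.inv.smul hF

theorem isProbabilityMeasure_spectralLaw (hF : Measurable F)
    (h0 : ∫⁻ s, ‖F s‖ₑ ^ α ∂m ≠ 0) (htop : ∫⁻ s, ‖F s‖ₑ ^ α ∂m ≠ ⊤) :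
    IsProbabilityMeasure (spectralLaw α m F) := by
  constructor
  rw [spectralLaw, Measure.map_apply (measurable_direction hF) .univ, Set.preimage_univ,
    Measure.smul_apply, withDensity_apply _ .univ, Measure.restrict_univ, smul_eq_mul,
    ENNReal.inv_mul_cancel h0 htop]

theorem ae_spectralLaw_norm_eq_one (hα : 0 < α) (hF : Measurable F) :
    ∀ᵐ v ∂(spectralLaw α m F), ‖v‖ = 1 := by
  rw [spectralLaw, ae_map_iff (measurable_direction hF).aemeasurable
    (measurableSet_eq_fun measurable_norm measurable_const)]
  refine Measure.ae_smul_measure ?_ _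
  rw [ae_withDensity_iff (hF.enorm.pow_const α)]
  refine .of_forall fun s hs => ?_
  have : ‖F s‖ ≠ 0 := by
    intro h
    rw [norm_eq_zero] at h
    simp [h, hα] at hs
  rw [norm_smul, norm_inv, norm_norm, inv_mul_cancel₀ this]

theorem lintegral_spectralLaw (hα : 0 < α) (hF : Measurable F) {l : (ι → ℝ) → ℝ}
    (hl : Measurable l) (hsmul : ∀ (a : ℝ) v, l (a • v) = a * l v) :
    ∫⁻ v, ENNReal.ofReal (|l v| ^ α) ∂(spectralLaw α m F)
      = (∫⁻ s, ‖F s‖ₑ ^ α ∂m)⁻¹ * ∫⁻ s, ENNReal.ofReal (|l (F s)| ^ α) ∂m := by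
  have hm : Measurable fun v => ENNReal.ofReal (|l v| ^ α) :=
    (hl.norm.pow_const α).ennreal_ofReal
  have hm' : Measurable fun s => ENNReal.ofReal (|l (‖F s‖⁻¹ • F s)| ^ α) :=
    hm.comp (measurable_direction hF)
  have hl0 : l 0 = 0 := by simpa using hsmul 0 0
  rw [spectralLaw, lintegral_map hm (measurable_direction hF), lintegral_smul_measure, smul_eq_mul,
    lintegral_withDensity_eq_lintegral_mul _ (hF.enorm.pow_const α) hm']
  congr 1
  refine lintegral_congr fun s => ?_
  rw [Pi.mul_apply]
  by_cases h : F s = 0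
  · simp [h, hl0, hα, Real.zero_rpow hα.ne']
  · have hpos : 0 < ‖F s‖ := norm_pos_iff.2 h
    rw [← ofReal_norm, ENNReal.ofReal_rpow_of_nonneg (norm_nonneg _) hα.le,
      ← ENNReal.ofReal_mul (by positivity), ← Real.mul_rpow (norm_nonneg _) (abs_nonneg _), hsmul,
      abs_mul, abs_inv, abs_norm, mul_inv_cancel_left₀ hpos.ne']

theorem integral_spectralLaw (hα : 0 < α) (hF : Measurable F) (θ : ι → ℝ) :
    ∫ v, |∑ t, θ t * v t| ^ α ∂(spectralLaw α m F)
      = (∫⁻ s, ‖F s‖ₑ ^ α ∂m).toReal⁻¹ * ∫ s, |∑ t, θ t * F s t| ^ α ∂m := by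
  have hl := measurable_linearForm θ
  have hm : Measurable fun v : ι → ℝ => |∑ t, θ t * v t| ^ α := hl.norm.pow_const α
  have hm' : Measurable fun s => |∑ t, θ t * F s t| ^ α := hm.comp hF
  rw [integral_eq_lintegral_of_nonneg_ae (.of_forall fun v => by positivity)
      hm.aestronglyMeasurable,
    integral_eq_lintegral_of_nonneg_ae (.of_forall fun s => by positivity)
      hm'.aestronglyMeasurable,
    lintegral_spectralLaw hα hF hl fun a v => ?_, ENNReal.toReal_mul, ENNReal.toReal_inv]
  rw [Finset.mul_sum]
  exact Finset.sum_congr rfl fun t _ => by simp only [Pi.smul_apply, smul_eq_mul]; ring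

end Spectral

/-! ### Maxima of stable fields -/

section Field

variable {G S Ω : Type*} [MeasurableSpace S] [MeasurableSpace Ω] {m : Measure S} {P : Measure Ω}
  {F : G → S → ℝ} {X : G → Ω → ℝ} {α : ℝ}

theorem HasStableIntegralRep.restrict (hX : HasStableIntegralRep α m F P X) (A : Finset G)
    (θ : A → ℝ) :
    ∫ ω, Complex.exp (((∑ t : A, θ t * X t ω : ℝ) : ℂ) * Complex.I) ∂P
      = ((Real.exp (-∫ s, |∑ t : A, θ t * F t s| ^ α ∂m) : ℝ) : ℂ) := by
  set θ' : G → ℝ := Function.extend Subtype.val θ 0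
  have hθ (t : A) : θ t = θ' t := (Subtype.val_injective.extend_apply θ 0 t).symm
  have hsum (x : G → ℝ) : ∑ t : A, θ t * x t = ∑ t ∈ A, θ' t * x t := by
    rw [← Finset.sum_coe_sort A]
    exact Finset.sum_congr rfl fun t _ => by rw [hθ]
  have h := hX.charFun_eq A θ'
  have h1 (ω) := hsum fun t => X t ω
  have h2 (s) := hsum fun t => F t s
  simp only [h1, h2]
  exact h

/-- For finitely many members of a stable field, the maximum of the absolute values, divided by
`(∫ max |F_t|^α dm / C)^{1/α}`, is almost Fréchet distributed if no single kernel is large. -/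
theorem HasStableIntegralRep.abs_integral_sub_le [IsProbabilityMeasure P]
    (hX : HasStableIntegralRep α m F P X) (hα : 0 < α) (hα2 : α < 2)
    (hF : ∀ t, Measurable (F t)) (A : Finset G) {B ρ : ℝ} (hB : 0 < B) (hρ : 0 ≤ ρ)
    (hAB : ∫⁻ s, ‖fun t : A => F t s‖ₑ ^ α ∂m = ENNReal.ofReal B)
    (hFρ : ∀ t, ∫⁻ s, ‖F t s‖ₑ ^ α ∂m ≤ ENNReal.ofReal (B * ρ))
    {ε δ : ℝ} (hε : 0 < ε) (hδ : 0 < δ) {h : ℝ → ℝ} {L : NNReal} {H : ℝ}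
    (hL : LipschitzWith L h) (hH : ∀ u v, dist (h u) (h v) ≤ H) :
    |∫ ω, h (((B / stableConst α) ^ (1 / α))⁻¹ * ‖fun t : A => X t ω‖) ∂P
      - ∫ z, h z ∂(frechet α hα)| ≤ L * (δ + ε) + H * errorBound α A.card ρ ε δ := by
  have hC := stableConst_pos hα hα2
  set a := (B / stableConst α) ^ (1 / α) with ha_def
  have ha : 0 < a := by positivity
  have haα : a⁻¹ ^ α = stableConst α / B := by
    rw [Real.inv_rpow ha.le, ha_def, ← Real.rpow_mul (by positivity), one_div_mul_cancel hα.ne',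
      Real.rpow_one, inv_div]
  set Fv : S → A → ℝ := fun s t => F t s
  have hFv : Measurable Fv := measurable_pi_lambda _ fun t => hF t
  have h0 : ∫⁻ s, ‖Fv s‖ₑ ^ α ∂m ≠ 0 := by rw [hAB]; simpa using hB
  have htop : ∫⁻ s, ‖Fv s‖ₑ ^ α ∂m ≠ ⊤ := by rw [hAB]; exact ENNReal.ofReal_ne_top
  have := isProbabilityMeasure_spectralLaw hFv h0 htop
  set Y : Ω → A → ℝ := fun ω => a⁻¹ • fun t : A => X t ω
  have hY : AEMeasurable Y P :=
    (aemeasurable_pi_lambda _ fun t : A => hX.aemeasurable t).const_smul a⁻¹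
  have hnorm (ω) : ‖Y ω‖ = a⁻¹ * ‖fun t : A => X t ω‖ := by
    rw [norm_smul, Real.norm_eq_abs, abs_of_pos (inv_pos.2 ha)]
  have key := abs_integral_norm_sub_le (τ := spectralLaw α m Fv) hα hα2
    (ae_spectralLaw_norm_eq_one hα hFv) hρ (fun t => ?_) hY (fun θ => ?_) hε hδ hL hH
  · simpa only [hnorm, Fintype.card_coe] using key
  · rw [lintegral_spectralLaw hα hFv (measurable_pi_apply t) fun _ _ => rfl, hAB]
    have h1 : ∫⁻ s, ENNReal.ofReal (|Fv s t| ^ α) ∂m ≤ ENNReal.ofReal (B * ρ) := by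
      refine le_trans (le_of_eq (lintegral_congr fun s => ?_)) (hFρ t)
      rw [← ENNReal.ofReal_rpow_of_nonneg (abs_nonneg _) hα.le, ← Real.enorm_eq_ofReal_abs]
    refine (mul_le_mul_right h1 _).trans (le_of_eq ?_)
    rw [ENNReal.ofReal_mul hB.le, ← mul_assoc,
      ENNReal.inv_mul_cancel (by simpa using hB) ENNReal.ofReal_ne_top, one_mul]
  · have h1 (x : A → ℝ) : ∑ t, θ t * (a⁻¹ • x) t = ∑ t, (a⁻¹ * θ t) * x t :=
      Finset.sum_congr rfl fun t _ => by simp only [Pi.smul_apply, smul_eq_mul]; ring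
    have h2 (x : A → ℝ) : |∑ t, (a⁻¹ * θ t) * x t| ^ α
        = stableConst α / B * |∑ t, θ t * x t| ^ α := by
      simp only [mul_assoc]
      rw [← Finset.mul_sum, abs_mul, abs_of_pos (inv_pos.2 ha),
        Real.mul_rpow (inv_pos.2 ha).le (abs_nonneg _), haα]
    simp only [Y, h1]
    rw [hX.restrict A fun t => a⁻¹ * θ t, integral_spectralLaw hα hFv, hAB,
      ENNReal.toReal_ofReal hB.le]
    simp only [h2 fun t : A => F t _]
    rw [integral_const_mul]
    congr 3
    simp only [Fv]
    ring

end Field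

/-- In dimension `N`, with moments of order `1 / N`, the error bound for `ε = δ²` converges, as
`N → ∞`, to a positive power of `δ`. -/
theorem tendsto_errorBound {α : ℝ} (K : ℝ) {δ : ℝ} (hδ : 0 < δ) {N : ℕ → ℝ}
    (hN : Tendsto N atTop atTop) :
    Tendsto (fun n => errorBound α (N n) (K / N n) (δ ^ 2) δ) atTop
      (𝓝 (α / (2 - α) * K * (δ ^ 2) ^ (2 - α))) := by
  set c := α / (2 - α) with hc
  set p := (δ ^ 2) ^ (2 - α) with hp
  set q := (δ ^ 2) ^ (-α) with hq
  have h1 : Tendsto (fun n => ((K * q) ^ 2 + 3 * (c * K * p) ^ 2 / δ ^ 4) / N n + c * K * p) atTop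
      (𝓝 (0 + c * K * p)) := (tendsto_const_nhds.div_atTop hN).add_const _
  rw [zero_add] at h1
  refine h1.congr' ?_
  filter_upwards [hN.eventually_gt_atTop 0] with n hn
  rw [errorBound, ← hc, ← hp, ← hq]
  field_simp
  ring

theorem exists_delta {α : ℝ} (hα2 : α < 2) (L H c : ℝ) {η : ℝ} (hη : 0 < η) :
    ∃ δ : ℝ, 0 < δ ∧ L * (δ + δ ^ 2) + H * (c * (δ ^ 2) ^ (2 - α)) < η := by
  have h1 : ContinuousAt
      (fun δ : ℝ => L * (δ + δ ^ 2) + H * (c * (δ ^ 2) ^ (2 - α))) 0 := by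
    refine ContinuousAt.add (by fun_prop) (continuousAt_const.mul (continuousAt_const.mul ?_))
    exact (by fun_prop : ContinuousAt (fun δ : ℝ => δ ^ 2) 0).rpow_const
      (Or.inr (by linarith))
  have h2 := h1.tendsto
  rw [zero_pow two_ne_zero, Real.zero_rpow (by linarith : 2 - α ≠ 0)] at h2
  simp only [add_zero, mul_zero] at h2
  have h3 := (h2.mono_left (nhdsWithin_le_nhds (s := Set.Ioi 0))).eventually (gt_mem_nhds hη)
  obtain ⟨δ, hδ1, hδ2⟩ := (h3.and self_mem_nhdsWithin).exists
  exact ⟨δ, hδ2, hδ1⟩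

theorem aemeasurable_partialMax {d : ℕ} {Ω : Type*} [MeasurableSpace Ω] {P : Measure Ω}
    {X : FreeGroup (Fin d) → Ω → ℝ} (hX : ∀ t, AEMeasurable (X t) P) (n : ℕ) :
    AEMeasurable (partialMax X n) P := by
  have : partialMax X n = fun ω => ‖fun t : ball d n => X t ω‖ :=
    funext fun ω => (norm_restrict_eq_sup' _ _ fun t => X t ω).symm
  rw [this]
  exact (aemeasurable_pi_lambda _ fun t : ball d n => hX t).norm

section Limit

variable {d : ℕ} {S Ω : Type*} [MeasurableSpace S] [MeasurableSpace Ω] {m : Measure S}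
  [SigmaFinite m] {φ : FreeGroup (Fin d) → S → S} {α : ℝ} {c : FreeGroup (Fin d) → S → ℝ}
  {f : S → ℝ} {P : Measure Ω} [IsProbabilityMeasure P] {X : FreeGroup (Fin d) → Ω → ℝ}

/-- If the averages of the maximal function stay away from zero, then `M_n`, normalised by
`(b_n(f)^α / C)^{1/α}`, converges in distribution to the Fréchet law. The test functions `g n` may
vary with `n`, as long as they have the same Lipschitz constant. -/
theorem tendsto_integral_partialMax_sub (hd : 2 ≤ d) (hφ : IsNonsingularAction m φ) (hα : 0 < α)
    (hα2 : α < 2) (hcm : ∀ t, Measurable (c t)) (hc : ∀ t s, c t s = 1 ∨ c t s = -1)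
    (hf : Measurable f) (hfi : ∫⁻ s, ‖f s‖ₑ ^ α ∂m ≠ ⊤)
    (hpos : ∃ ε > 0, ∀ᶠ n in atTop, ε ≤ avgMax m φ (fun s => ‖f s‖ₑ ^ α) n)
    (hX : HasStableIntegralRep α m (kernel α m φ c f) P X) {g : ℕ → ℝ → ℝ} {L : NNReal} {H : ℝ}
    (hL : ∀ n, LipschitzWith L (g n)) (hH : ∀ n u v, dist (g n u) (g n v) ≤ H) :
    Tendsto (fun n => ∫ ω, g n ((((maxIntegral m φ (fun s => ‖f s‖ₑ ^ α) (ball d n) id).toReal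
        / stableConst α) ^ (1 / α))⁻¹ * partialMax X n ω) ∂P - ∫ z, g n z ∂(frechet α hα))
      atTop (𝓝 0) := by
  obtain ⟨ε₀, hε₀, hev⟩ := hpos
  set W := (∫⁻ s, ‖f s‖ₑ ^ α ∂m).toReal with hW
  have hW0 : 0 ≤ W := ENNReal.toReal_nonneg
  have hH0 : 0 ≤ H := dist_nonneg.trans (hH 0 0 0)
  set K := W / ε₀ with hK
  rw [Metric.tendsto_atTop]
  intro η hη
  obtain ⟨δ, hδ, hδη⟩ := exists_delta hα2 L H (α / (2 - α) * K) hη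
  have hlim := ((tendsto_errorBound (α := α) K hδ (tendsto_card_ball (d := d) (by omega))).const_mul
    H).const_add (L * (δ + δ ^ 2))
  obtain ⟨n₀, hn₀⟩ := eventually_atTop.1 ((hlim.eventually (gt_mem_nhds hδη)).and hev)
  refine ⟨n₀, fun n hn => ?_⟩
  obtain ⟨hn1, hn2⟩ := hn₀ n hn
  have hNpos := card_ball_pos d n
  set N : ℝ := ((ball d n).card : ℝ)
  set B := (maxIntegral m φ (fun s => ‖f s‖ₑ ^ α) (ball d n) id).toReal with hB
  have hBN : ε₀ * N ≤ B := by rwa [avgMax, le_div_iff₀ hNpos] at hn2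
  have hBpos : 0 < B := (mul_pos hε₀ hNpos).trans_le hBN
  have hWB : W ≤ B * (K / N) := by
    rw [hK, div_div, ← mul_div_assoc, le_div_iff₀ (by positivity), mul_comm B]
    exact mul_le_mul_of_nonneg_left hBN hW0
  have hbound := hX.abs_integral_sub_le (ε := δ ^ 2) (δ := δ) (ρ := K / N) (B := B) hα hα2
    (measurable_kernel hφ hcm hf) (ball d n) hBpos (by positivity)
    (by rw [lintegral_enorm_restrict_kernel hφ hα hc f _ (ball_nonempty d n), hB,
          ENNReal.ofReal_toReal
            (maxIntegral_ball_ne_top hφ (hf.enorm.pow_const α) hfi n)])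
    (fun t => by
      rw [lintegral_enorm_kernel_rpow hφ hα hc hf, ← ENNReal.ofReal_toReal hfi]
      exact ENNReal.ofReal_le_ofReal hWB)
    (by positivity) hδ (hL n) (hH n)
  rw [dist_zero_right, Real.norm_eq_abs]
  have hmax (ω) := norm_restrict_eq_sup' (ball d n) (ball_nonempty d n) fun t => X t ω
  simp only [hmax] at hbound
  exact hbound.trans_lt hn1

/-- The subsequence is chosen such that `b_n(f)^α / |E_n|` converges along it, by compactness; the
scale `κ` is the limit of the ratio of the two normalisations of `M_n`. -/
theorem exists_subseq_tendstoInDistribution (hd : 2 ≤ d) (hφ : IsNonsingularAction m φ)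
    (hα : 0 < α) (hα2 : α < 2) (hcm : ∀ t, Measurable (c t))
    (hc : ∀ t s, c t s = 1 ∨ c t s = -1)
    (hf : Measurable f) (hfi : ∫⁻ s, ‖f s‖ₑ ^ α ∂m ≠ ⊤)
    (hpos : ∃ ε > 0, ∀ᶠ n in atTop, ε ≤ avgMax m φ (fun s => ‖f s‖ₑ ^ α) n)
    (hX : HasStableIntegralRep α m (kernel α m φ c f) P X) {k : ℕ → ℕ} (hk : StrictMono k) :
    ∃ l : ℕ → ℕ, StrictMono l ∧ ∃ κ : ℝ, 0 < κ ∧ TendstoInDistribution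
      (fun j ω => partialMax X (k (l j)) ω / ((ball d (k (l j))).card : ℝ) ^ (1 / α))
      atTop (fun z : ℝ => κ * z) (fun _ => P) (frechet α hα) := by
  have hC := stableConst_pos hα hα2
  set W := (∫⁻ s, ‖f s‖ₑ ^ α ∂m).toReal
  set av := avgMax m φ (fun s => ‖f s‖ₑ ^ α)
  have havW (n : ℕ) : av n ≤ W := avgMax_le hφ (hf.enorm.pow_const α) hfi n
  obtain ⟨ε₀, hε₀, hev⟩ := id hpos
  obtain ⟨q, -, l, hl, hlim⟩ := (isCompact_Icc (a := (0 : ℝ)) (b := W)).tendsto_subseq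
    (x := fun j => av (k j)) fun j => ⟨avgMax_nonneg _ _, havW _⟩
  have hkl : Tendsto (fun j => k (l j)) atTop atTop := (hk.comp hl).tendsto_atTop
  have hq : 0 < q := hε₀.trans_le (ge_of_tendsto hlim (hkl.eventually hev))
  have hα' : 0 < 1 / α := by positivity
  have hmeas (n : ℕ) : AEMeasurable
      (fun ω => partialMax X n ω / ((ball d n).card : ℝ) ^ (1 / α)) P :=
    (aemeasurable_partialMax hX.aemeasurable n).div_const _
  refine ⟨l, hl, (q / stableConst α) ^ (1 / α), by positivity, ?_⟩
  refine ⟨fun j => hmeas _, by fun_prop, ?_⟩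
  refine tendsto_iff_forall_lipschitz_integral_tendsto.2 ?_
  rintro h ⟨H, hH⟩ ⟨L, hL⟩
  -- `M_n / |E_n|^{1/α}` is `r n` times the maximum in its natural normalisation
  set r : ℕ → ℝ := fun n => (av n / stableConst α) ^ (1 / α)
  have hr0 (n) : 0 ≤ r n := Real.rpow_nonneg (div_nonneg (avgMax_nonneg _ _) hC.le) _
  set R := (W / stableConst α) ^ (1 / α)
  have hrR (n) : r n ≤ R := Real.rpow_le_rpow (div_nonneg (avgMax_nonneg _ _) hC.le)
    (div_le_div_of_nonneg_right (havW n) hC.le) hα'.le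
  have hLip (n) : LipschitzWith (L * R.toNNReal) fun z => h (r n * z) := by
    refine hL.comp ((LipschitzWith.of_dist_le_mul fun x y => ?_) : LipschitzWith R.toNNReal _)
    rw [Real.dist_eq, Real.dist_eq, ← mul_sub, abs_mul, abs_of_nonneg (hr0 n)]
    exact mul_le_mul_of_nonneg_right ((hrR n).trans (Real.le_coe_toNNReal R)) (abs_nonneg _)
  have hmain := (tendsto_integral_partialMax_sub hd hφ hα hα2 hcm hc hf hfi hpos hX
    (g := fun n z => h (r n * z)) hLip fun n u v => hH _ _).comp hkl
  have hfr : Tendsto (fun j => ∫ z, h (r (k (l j)) * z) ∂(frechet α hα)) atTop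
      (𝓝 (∫ z, h ((q / stableConst α) ^ (1 / α) * z) ∂(frechet α hα))) := by
    have hrlim : Tendsto (fun j => r (k (l j))) atTop (𝓝 ((q / stableConst α) ^ (1 / α))) :=
      (hlim.div_const _).rpow_const (Or.inr hα'.le)
    refine tendsto_integral_of_dominated_convergence (fun _ => |h 0| + H)
      (fun j => (hLip _).continuous.aestronglyMeasurable) (integrable_const _)
      (fun j => .of_forall fun z => ?_)
      (.of_forall fun z => (hL.continuous.tendsto _).comp (hrlim.mul_const z))
    have := hH (r (k (l j)) * z) 0
    rw [Real.dist_eq] at this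
    rw [Real.norm_eq_abs]
    linarith [abs_sub_abs_le_abs_sub (h (r (k (l j)) * z)) (h 0)]
  have hsum := hmain.add hfr
  rw [zero_add] at hsum
  have hhm := hL.continuous.measurable
  have e0 : ∫ z, h z ∂((frechet α hα).map fun z => (q / stableConst α) ^ (1 / α) * z)
      = ∫ z, h ((q / stableConst α) ^ (1 / α) * z) ∂(frechet α hα) :=
    integral_map (by fun_prop) hhm.aestronglyMeasurable
  change Tendsto (fun j => ∫ z, h z ∂(P.map _)) _ (𝓝 (∫ z, h z ∂((frechet α hα).map _)))
  rw [e0]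
  refine hsum.congr' ?_
  filter_upwards [hkl.eventually hev] with j hj
  rw [integral_map (hmeas _) hhm.aestronglyMeasurable]
  simp only [Function.comp_apply, sub_add_cancel]
  refine integral_congr_ae (.of_forall fun ω => ?_)
  dsimp only
  congr 1
  have hN := card_ball_pos d (k (l j))
  have hav : 0 < av (k (l j)) := hε₀.trans_le hj
  have hB : (maxIntegral m φ (fun s => ‖f s‖ₑ ^ α) (ball d (k (l j))) id).toReal
      = av (k (l j)) * (ball d (k (l j))).card := (div_mul_cancel₀ _ hN.ne').symm
  rw [hB, mul_div_right_comm, Real.mul_rpow (by positivity) hN.le]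
  have : 0 < (av (k (l j)) / stableConst α) ^ (1 / α) := by positivity
  simp only [r]
  field_simp

end Limit

theorem HasStableIntegralRep.congr {G S Ω : Type*} [MeasurableSpace S] [MeasurableSpace Ω] {α : ℝ}
    {m : Measure S} {F F' : G → S → ℝ} {P : Measure Ω} {X : G → Ω → ℝ}
    (hX : HasStableIntegralRep α m F P X) (h : ∀ t, F t =ᵐ[m] F' t) :
    HasStableIntegralRep α m F' P X where
  aemeasurable := hX.aemeasurable
  charFun_eq T θ := by
    rw [hX.charFun_eq T θ]
    congr 3
    refine integral_congr_ae ?_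
    filter_upwards [(ae_ball_iff T.countable_toSet).2 fun t _ => h t] with s hs
    rw [Finset.sum_congr rfl fun t ht => by rw [hs t ht]]

end StableField

theorem theorem2 {d : ℕ} (hd : 2 ≤ d)
    {S : Type*} [MeasurableSpace S] [StandardBorelSpace S] (m : Measure S) [SigmaFinite m]
    (α : ℝ) (hα : 0 < α) (hα2 : α < 2)
    (φ : FreeGroup (Fin d) → S → S) (hφ : StableField.IsNonsingularAction m φ)
    (c : FreeGroup (Fin d) → S → ℝ) (hcm : ∀ t, Measurable (c t))
    (hc : ∀ t s, c t s = 1 ∨ c t s = -1)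
    (A : Set S) (hA : StableField.IsNondegeneratePart α m φ c A)
    (f : S → ℝ) (hf : MemLp f (ENNReal.ofReal α) m)
    (hfA : 0 < m (Function.support f ∩ A)) :
    0 < liminf (StableField.bRatio α m φ c f) atTop ∧
    ∀ {Ω : Type*} [MeasurableSpace Ω] (P : Measure Ω) [IsProbabilityMeasure P]
      (X : FreeGroup (Fin d) → Ω → ℝ),
      StableField.HasStableIntegralRep α m (StableField.kernel α m φ c f) P X →
      ∀ k : ℕ → ℕ, StrictMono k → ∃ l : ℕ → ℕ, StrictMono l ∧ ∃ κ : ℝ, 0 < κ ∧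
        TendstoInDistribution
          (fun j ω => StableField.partialMax X (k (l j)) ω
            / ((StableField.ball d (k (l j))).card : ℝ) ^ (1 / α))
          atTop (fun z : ℝ => κ * z) (fun _ => P) (StableField.frechet α hα) := by
  -- `f` may be replaced by a measurable function which is equal to it almost everywhere
  obtain ⟨f', hf'm, hff'⟩ := hf.1.aemeasurable
  have hf' : MemLp f' (ENNReal.ofReal α) m := (memLp_congr_ae hff').1 hf
  have hsupp : (Function.support f ∩ A : Set S) =ᵐ[m] (Function.support f' ∩ A : Set S) := by
    filter_upwards [hff'] with s hs
    exact congrArg (fun x : ℝ => x ≠ 0 ∧ s ∈ A) hs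
  rw [measure_congr hsupp] at hfA
  have hpos := StableField.exists_le_avgMax hd hφ hα hcm hc hA hf'm hf' hfA
  rw [StableField.bRatio_congr_ae hφ hff']
  refine ⟨StableField.liminf_bRatio_pos hφ hα hcm hc hf'm hf' hpos, ?_⟩
  intro Ω _ P _ X hX k hk
  exact StableField.exists_subseq_tendstoInDistribution hd hφ hα hα2 hcm hc hf'm
    (StableField.lintegral_enorm_rpow_ne_top hα hf') hpos
    (hX.congr fun t => StableField.kernel_congr_ae hφ hff' t) hk
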